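/- Let $\Omega\subset\mathbf R^d$ be a bounded open set with $\operatorname{int}\overline\Omega=\Omega$, and let $\mathcal T_h$ be a partition of $\Omega$ into finitely many labelled closed convex polytopes $K$ with nonempty, pairwise disjoint interiors and $\bigcup K=\overline\Omega$ (hanging nodes are allowed). The interior faces $e\in\mathcal E_h^I$ are the $(d-1)$-dimensional intersections $e=\partial K\cap\partial K'$, where $K$ has the smaller label, and $n_e=n_K|_e=-n_{K'}|_e$ is the unit normal. The boundary faces $e\in\mathcal E_h^B$ are the $(d-1)$-dimensional flat parts of $\partial K\cap\partial\Omega$, with outer unit normal $n_e$. Put $\mathcal E_h=\mathcal E_h^I\cup\mathcal E_h^B$. On interior faces let $[v]=v|_K-v|_{K'}$ and $\{v\}=\frac12(v|_K+v|_{K'})$; on boundary faces $[v]=v$. Let $V_r^h=\prod_K\mathbb P_r(K)$, where $r\ge0$ and $\mathbb P_r$ denotes polynomials of total degree at most $r$, and let $\mathcal V_h=\prod_K W^{1,1}(K)\cap\prod_K C^0(\overline K)$. Write $(v,w)_{\mathcal T_h}=\sum_K\int_K vw\,dx$ and $\langle v,w\rangle_{\mathcal S}=\sum_{e\in\mathcal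 S}\int_e vw\,ds$. For $v\in\mathcal V_h$, $1\le i\le d$ and an interior face $e$, let $\mathcal Q_i^-(v)=v|_K$ and $\mathcal Q_i^+(v)=v|_{K'}$ if $n_e^{(i)}<0$, and $\mathcal Q_i^-(v)=v|_{K'}$ and $\mathcal Q_i^+(v)=v|_K$ if $n_e^{(i)}\ge0$; on boundary faces $\mathcal Q_i^\pm(v)=v$. The discrete derivatives (with the parameters $\gamma_i^\pm$ equal to $0$) are the elements $\partial_{h,x_i}^\pm v\in V_r^h$ with $$(\partial_{h,x_i}^\pm v,\varphi_h)_{\mathcal T_h}=\langle\mathcal Q_i^\pm(v)\,n^{(i)},[\varphi_h]\rangle_{\mathcal E_h}-(v,\partial_{x_i}\varphi_h)_{\mathcal T_h}\qquad\forall\varphi_h\in V_r^h,$$ and $\partial_{h,x_i}v=\frac12(\partial_{h,x_i}^-v+\partial_{h,x_i}^+v)$. For every $v\in\mathcal V_h$, $r\ge0$ and $1\le i\le d$: (a) $\partial_{h,x_i}^\pm v$ exist and are unique. (b) The distributional derivative of $v$ on $\Omega$ is $$\mathcal D_{x_i}v=\sum_{K\in\mathcal T_h}\partial_{x_i}v\,\chi_K-\sum_{e\in\mathcal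 E_h^I}n_e^{(i)}\,\delta(e,[v],\cdot)\quad\text{in }\mathcal D'(\Omega),$$ where $\partial_{x_i}v$ is the weak derivative on each cell and $\langle\delta(e,g,\cdot),\varphi\rangle=\int_e g\varphi\,ds$. (c) $\partial_{h,x_i}v$ is the $L^2$ projection of $\mathcal D_{x_i}v$ onto $V_r^h$: it is the unique element of $V_r^h$ such that $$(\partial_{h,x_i}v,\varphi_h)_{\mathcal T_h}=\langle\mathcal D_{x_i}v,\varphi_h\rangle\qquad\forall\varphi_h\in V_r^h,$$ where the right-hand side is understood through the representation in (b) and $\langle\delta(e,g,\cdot),\varphi_h\rangle:=\int_e g\,\{\varphi_h\}\,ds$, that is, $$\langle\mathcal D_{x_i}v,\varphi_h\rangle=(\partial_{x_i}v,\varphi_h)_{\mathcal T_h}-\sum_{e\in\mathcal E_h^I}n_e^{(i)}\int_e[v]\,\{\varphi_h\}\,ds.$$ -/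

import Mathlib

open MeasureTheory TopologicalSpace
open scoped Distributions LineDeriv MeasureTheory

noncomputable section

namespace DGCalculus

/-- The Euclidean space `ℝ^d`. -/
abbrev Euc (d : ℕ) : Type := EuclideanSpace ℝ (Fin d)

/-- The `i`-th coordinate direction. -/
def coordDir {d : ℕ} (i : Fin d) : Euc d := EuclideanSpace.single i 1

/-- The `(d-1)`-dimensional surface measure `ds`, normalised so as to agree with Lebesgue measure
on hyperplanes (counting measure if `d = 1`). -/
abbrev surface (d : ℕ) : Measure (Euc d) := μHE[d - 1]

/-! ### Distributions -/

/-- The regular distribution `φ ↦ ∫ f φ dx` on the open set `U`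
(for `f` locally integrable on `U`). -/
def regularDist {d : ℕ} (U : Opens (Euc d)) (f : Euc d → ℝ) : 𝓓'(U, ℝ) :=
  TestFunction.integralAgainstBilinCLM (ContinuousLinearMap.mul ℝ ℝ) volume f

/-- The delta function of variable strength `g` supported on `Ξ`, that is `φ ↦ ∫_Ξ g φ ds`
(for `g` integrable on `Ξ`). -/
def deltaDist {d : ℕ} (U : Opens (Euc d)) (Ξ : Set (Euc d)) (g : Euc d → ℝ) : 𝓓'(U, ℝ) :=
  TestFunction.integralAgainstBilinCLM (ContinuousLinearMap.mul ℝ ℝ)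
    ((surface d).restrict Ξ) g

/-- `g ∈ L¹(U)` is the weak partial derivative of `f` in the direction `x_i` on `U`. -/
def IsWeakPartial {d : ℕ} (U : Opens (Euc d)) (i : Fin d) (f g : Euc d → ℝ) : Prop :=
  IntegrableOn g U ∧ ∂_{coordDir i} (regularDist U f) = regularDist U g

/-- `f ∈ W^{1,1}(U)`. -/
def MemW11 {d : ℕ} (U : Opens (Euc d)) (f : Euc d → ℝ) : Prop :=
  IntegrableOn f U ∧ ∀ i : Fin d, ∃ g : Euc d → ℝ, IsWeakPartial U i f g

/-! ### Cells and meshes -/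

/-- A closed, bounded, nondegenerate convex polytope, presented by finitely many half-spaces
`⟪n, x⟫ ≤ c` with unit vector `n`. Redundant half-spaces are harmless. -/
structure Polytope (d : ℕ) where
  halfSpaces : Finset (Euc d × ℝ)
  norm_eq_one : ∀ a ∈ halfSpaces, ‖a.1‖ = 1
  isBounded : Bornology.IsBounded {x : Euc d | ∀ a ∈ halfSpaces, inner ℝ a.1 x ≤ a.2}
  nonempty_interior : (interior {x : Euc d | ∀ a ∈ halfSpaces, inner ℝ a.1 x ≤ a.2}).Nonempty

namespace Polytope

variable {d : ℕ}

/-- The points of the closed cell. -/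
def carrier (K : Polytope d) : Set (Euc d) := {x | ∀ a ∈ K.halfSpaces, inner ℝ a.1 x ≤ a.2}

/-- The interior of the cell, as an open set. -/
def inside (K : Polytope d) : Opens (Euc d) := ⟨interior K.carrier, isOpen_interior⟩

/-- The flat part of the boundary of the cell on the hyperplane `⟪a.1, x⟫ = a.2`; for
`a ∈ K.halfSpaces`, the outer unit normal of the cell on it is `a.1`. -/
def facet (K : Polytope d) (a : Euc d × ℝ) : Set (Euc d) := {x ∈ K.carrier | inner ℝ a.1 x = a.2}

theorem carrier_eq_iInter (K : Polytope d) :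
    K.carrier = ⋂ a ∈ K.halfSpaces, {x : Euc d | inner ℝ a.1 x ≤ a.2} := by
  ext x; simp [carrier]

theorem isClosed_carrier (K : Polytope d) : IsClosed K.carrier := by
  rw [carrier_eq_iInter]
  exact isClosed_biInter fun a _ => isClosed_le (by fun_prop) continuous_const

theorem convex_carrier (K : Polytope d) : Convex ℝ K.carrier := by
  rw [carrier_eq_iInter]
  exact convex_iInter₂ fun a _ =>
    convex_halfSpace_le (IsBoundedLinearMap.mk (𝕜 := ℝ) ((innerSL ℝ a.1).toLinearMap.isLinear)
      (innerSL ℝ a.1).isBoundedLinearMap.bound).toIsLinearMap a.2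

end Polytope

/-- A partition of the bounded open set `Ω` into finitely many labelled cells. The interior of
the closure of `Ω` is `Ω` itself, so that `Ω` lies on one side of its boundary faces. -/
structure Mesh {d : ℕ} (Ω : Opens (Euc d)) where
  numCells : ℕ
  cell : Fin numCells → Polytope d
  disjoint_interior : Pairwise fun k l =>
    Disjoint (interior (cell k).carrier) (interior (cell l).carrier)
  iUnion_cell : ⋃ k, (cell k).carrier = closure (Ω : Set (Euc d))
  interior_closure : interior (closure (Ω : Set (Euc d))) = Ω

namespace Mesh

variable {d : ℕ} {Ω : Opens (Euc d)} (𝓣 : Mesh Ω)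

/-- The interior faces: pairs of cells `K, K'`, the label of `K` being the smaller one, such that
`∂K ∩ ∂K'` is `(d-1)`-dimensional. -/
def InteriorFace : Type :=
  {p : Fin 𝓣.numCells × Fin 𝓣.numCells // p.1 < p.2 ∧
    0 < surface d (frontier (𝓣.cell p.1).carrier ∩ frontier (𝓣.cell p.2).carrier)}

/-- The boundary faces: the `(d-1)`-dimensional flat parts of `∂K ∩ ∂Ω`, `K` being a cell. -/
def BoundaryFace : Type :=
  {p : Σ k : Fin 𝓣.numCells, {a // a ∈ (𝓣.cell k).halfSpaces} //
    0 < surface d ((𝓣.cell p.1).facet p.2 ∩ frontier (Ω : Set (Euc d)))}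

instance : Finite 𝓣.InteriorFace := by unfold InteriorFace; infer_instance
instance : Finite 𝓣.BoundaryFace := by unfold BoundaryFace; infer_instance
instance : Fintype 𝓣.InteriorFace := Fintype.ofFinite _
instance : Fintype 𝓣.BoundaryFace := Fintype.ofFinite _

variable {𝓣}

namespace InteriorFace

/-- The label of the cell `K` of `e = ∂K ∩ ∂K'`. -/
def fst (e : 𝓣.InteriorFace) : Fin 𝓣.numCells := e.1.1

/-- The label of the cell `K'` of `e = ∂K ∩ ∂K'`. -/
def snd (e : 𝓣.InteriorFace) : Fin 𝓣.numCells := e.1.2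

/-- The points of `e = ∂K ∩ ∂K'`. -/
def carrier (e : 𝓣.InteriorFace) : Set (Euc d) :=
  frontier (𝓣.cell e.fst).carrier ∩ frontier (𝓣.cell e.snd).carrier

/-- `n` is an outer unit normal of `K` and an inner unit normal of `K'` on `e = ∂K ∩ ∂K'`. As `e`
is `(d-1)`-dimensional, there is only one such vector. -/
def IsNormal (e : 𝓣.InteriorFace) (n : Euc d) : Prop :=
  ‖n‖ = 1 ∧ ∀ x ∈ e.carrier,
    (∀ y ∈ (𝓣.cell e.fst).carrier, inner ℝ n (y - x) ≤ 0) ∧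
    (∀ y ∈ (𝓣.cell e.snd).carrier, 0 ≤ inner ℝ n (y - x))

theorem exists_isNormal (e : 𝓣.InteriorFace) : ∃ n, e.IsNormal n := by
  have hne : e.fst ≠ e.snd := ne_of_lt e.2.1
  have hd := 𝓣.disjoint_interior hne
  set K := 𝓣.cell e.fst with hK
  set K' := 𝓣.cell e.snd with hK'
  obtain ⟨f, u, h1, h2⟩ := geometric_hahn_banach_open_open K.convex_carrier.interior
    isOpen_interior K'.convex_carrier.interior isOpen_interior hd
  have c1 : ∀ y ∈ K.carrier, f y ≤ u := by
    have : K.carrier ⊆ closure (interior K.carrier) := by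
      rw [K.convex_carrier.closure_interior_eq_closure_of_nonempty_interior K.nonempty_interior]
      exact subset_closure
    intro y hy
    exact closure_minimal (t := {y | f y ≤ u}) (fun z hz => (h1 z hz).le)
      (isClosed_le f.continuous continuous_const) (this hy)
  have c2 : ∀ y ∈ K'.carrier, u ≤ f y := by
    have : K'.carrier ⊆ closure (interior K'.carrier) := by
      rw [K'.convex_carrier.closure_interior_eq_closure_of_nonempty_interior K'.nonempty_interior]
      exact subset_closure
    intro y hy
    exact closure_minimal (t := {y | u ≤ f y}) (fun z hz => (h2 z hz).le)
      (isClosed_le continuous_const f.continuous) (this hy)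
  set w : Euc d := (InnerProductSpace.toDual ℝ (Euc d)).symm f with hw
  have hfw : ∀ y, inner ℝ w y = f y := fun y => InnerProductSpace.toDual_symm_apply
  have hw0 : w ≠ 0 := by
    intro h0
    obtain ⟨a, ha⟩ := K.nonempty_interior
    obtain ⟨b, hb⟩ := K'.nonempty_interior
    have hab := (h1 a ha).trans (h2 b hb)
    rw [← hfw, ← hfw, h0] at hab
    simp at hab
  have hpos : 0 < ‖w‖⁻¹ := by positivity
  refine ⟨‖w‖⁻¹ • w, by simp [norm_smul, hw0], fun x hx => ?_⟩
  have hxK : x ∈ K.carrier := K.isClosed_carrier.frontier_subset hx.1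
  have hxK' : x ∈ K'.carrier := K'.isClosed_carrier.frontier_subset hx.2
  have hfx : f x = u := le_antisymm (c1 x hxK) (c2 x hxK')
  refine ⟨fun y hy => ?_, fun y hy => ?_⟩
  · rw [inner_smul_left, inner_sub_right, hfw, hfw, hfx]
    exact mul_nonpos_of_nonneg_of_nonpos hpos.le (sub_nonpos.2 (c1 y hy))
  · rw [inner_smul_left, inner_sub_right, hfw, hfw, hfx]
    exact mul_nonneg hpos.le (sub_nonneg.2 (c2 y hy))

/-- The unit normal `n_e = n_K|_e = -n_{K'}|_e`. -/
def normal (e : 𝓣.InteriorFace) : Euc d := e.exists_isNormal.choose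

end InteriorFace

namespace BoundaryFace

/-- The label of the cell to which the boundary face belongs. -/
def idx (e : 𝓣.BoundaryFace) : Fin 𝓣.numCells := e.1.1

/-- The outer unit normal `n_e`. -/
def normal (e : 𝓣.BoundaryFace) : Euc d := e.1.2.1.1

/-- The points of the boundary face. -/
def carrier (e : 𝓣.BoundaryFace) : Set (Euc d) :=
  (𝓣.cell e.idx).facet e.1.2.1 ∩ frontier (Ω : Set (Euc d))

end BoundaryFace

/-! ### Piecewise functions -/

variable (𝓣)

/-- Families of functions, one for each cell `K`; only the values on the closed cell matter. -/
abbrev Broken : Type := Fin 𝓣.numCells → Euc d → ℝ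

variable {𝓣}

/-- The function on `Ω` (defined off the faces, hence almost everywhere) given by a family. -/
def glue (w : 𝓣.Broken) (x : Euc d) : ℝ :=
  ∑ k, (interior (𝓣.cell k).carrier).indicator (w k) x

/-- The piecewise `L²` inner product `(v, w)_{𝓣}`. -/
def brokenInner (v w : 𝓣.Broken) : ℝ := ∑ k, ∫ x in (𝓣.cell k).carrier, v k x * w k x

/-- The jump on an interior face. The trace of a family on `∂K` from within `K` is the
value of the member with label `K`; see `PiecewiseSpace.tendsto_trace`. -/
def jump (w : 𝓣.Broken) (e : 𝓣.InteriorFace) (x : Euc d) : ℝ := w e.fst x - w e.snd x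

/-- The average on an interior face. -/
def average (w : 𝓣.Broken) (e : 𝓣.InteriorFace) (x : Euc d) : ℝ := (w e.fst x + w e.snd x) / 2

/-- The trace `Q_i^-` on an interior face. -/
def traceMinus (i : Fin d) (w : 𝓣.Broken) (e : 𝓣.InteriorFace) (x : Euc d) : ℝ :=
  if e.normal i < 0 then w e.fst x else w e.snd x

/-- The trace `Q_i^+` on an interior face. -/
def tracePlus (i : Fin d) (w : 𝓣.Broken) (e : 𝓣.InteriorFace) (x : Euc d) : ℝ :=
  if e.normal i < 0 then w e.snd x else w e.fst x

variable (𝓣)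

/-- The space `𝓥_h = W^{1,1}(𝓣_h) ∩ C⁰(𝓣_h)`. -/
structure PiecewiseSpace where
  toFun : 𝓣.Broken
  continuousOn : ∀ k, ContinuousOn (toFun k) (𝓣.cell k).carrier
  memW11 : ∀ k, MemW11 (𝓣.cell k).inside (toFun k)

variable {𝓣}

/-- The values on `∂K` are the limits from the interior of `K`. -/
theorem PiecewiseSpace.tendsto_trace (v : 𝓣.PiecewiseSpace) (k : Fin 𝓣.numCells) {x : Euc d}
    (hx : x ∈ (𝓣.cell k).carrier) :
    Filter.Tendsto (v.toFun k) (nhdsWithin x (interior (𝓣.cell k).carrier))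
      (nhds (v.toFun k x)) :=
  (v.continuousOn k x hx).mono_left (nhdsWithin_mono _ interior_subset)

/-- The piecewise weak partial derivative `∂_{x_i} v` (unique up to null sets). -/
def PiecewiseSpace.weakPartial (v : 𝓣.PiecewiseSpace) (i : Fin d) : 𝓣.Broken :=
  fun k => ((v.memW11 k).2 i).choose

/-- The distributional derivative `𝓓_{x_i} v` on `Ω`. -/
def PiecewiseSpace.distDeriv (v : 𝓣.PiecewiseSpace) (i : Fin d) : 𝓓'(Ω, ℝ) :=
  ∂_{coordDir i} (regularDist Ω (glue v.toFun))

variable (𝓣)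

/-- The discontinuous finite element space `V_r^h`: one polynomial of total degree at most `r` on
each cell. -/
abbrev DGSpace (r : ℕ) : Type :=
  Fin 𝓣.numCells → MvPolynomial.restrictTotalDegree (Fin d) ℝ r

variable {𝓣} {r : ℕ}

/-- The piecewise polynomial function of an element of `V_r^h`. -/
def DGSpace.toFun (p : 𝓣.DGSpace r) : 𝓣.Broken :=
  fun k x => MvPolynomial.eval (fun j => x j) (p k).1

/-- The piecewise partial derivative `∂_{x_i} φ_h` of an element of `V_r^h`. -/
def DGSpace.partialDeriv (p : 𝓣.DGSpace r) (i : Fin d) : 𝓣.Broken :=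
  fun k x => MvPolynomial.eval (fun j => x j) (MvPolynomial.pderiv i (p k).1)

/-! ### Discrete derivatives -/

/-- The functional
`φ ↦ ⟨Q v n^{(i)}, [φ]⟩_{𝓔} - (v, ∂_{x_i} φ)_{𝓣} + ⟨γ [v], [φ]⟩_{𝓔^I}` on `V_r^h`, where `Q` is the
trace operator used on the interior faces. On boundary faces trace and jump are one-sided. -/
def dgFunctional (Q : 𝓣.Broken → 𝓣.InteriorFace → Euc d → ℝ) (γ : 𝓣.InteriorFace → ℝ)
    (i : Fin d) (v : 𝓣.Broken) (φ : 𝓣.DGSpace r) : ℝ :=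
  (∑ e : 𝓣.InteriorFace,
      ∫ x in e.carrier, Q v e x * e.normal i * jump (DGSpace.toFun φ) e x ∂(surface d))
    + (∑ e : 𝓣.BoundaryFace,
      ∫ x in e.carrier, v e.idx x * e.normal i * DGSpace.toFun φ e.idx x ∂(surface d))
    - brokenInner v (DGSpace.partialDeriv φ i)
    + ∑ e : 𝓣.InteriorFace,
      ∫ x in e.carrier, γ e * jump v e x * jump (DGSpace.toFun φ) e x ∂(surface d)

/-- `p ∈ V_r^h` satisfies the equation that defines `∂_{h,x_i}^- v`. -/
def IsPartialMinus (γ : 𝓣.InteriorFace → ℝ) (i : Fin d) (v : 𝓣.PiecewiseSpace)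
    (p : 𝓣.DGSpace r) : Prop :=
  ∀ φ : 𝓣.DGSpace r, brokenInner (DGSpace.toFun p) (DGSpace.toFun φ) =
    dgFunctional (traceMinus i) γ i v.toFun φ

/-- `p ∈ V_r^h` satisfies the equation that defines `∂_{h,x_i}^+ v`. -/
def IsPartialPlus (γ : 𝓣.InteriorFace → ℝ) (i : Fin d) (v : 𝓣.PiecewiseSpace)
    (p : 𝓣.DGSpace r) : Prop :=
  ∀ φ : 𝓣.DGSpace r, brokenInner (DGSpace.toFun p) (DGSpace.toFun φ) =
    dgFunctional (tracePlus i) γ i v.toFun φ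

/-- The discrete derivative `∂_{h,x_i}^- v ∈ V_r^h`. -/
def partialMinus (r : ℕ) (γ : 𝓣.InteriorFace → ℝ) (i : Fin d) (v : 𝓣.PiecewiseSpace) :
    𝓣.DGSpace r :=
  Classical.epsilon (IsPartialMinus γ i v)

/-- The discrete derivative `∂_{h,x_i}^+ v ∈ V_r^h`. -/
def partialPlus (r : ℕ) (γ : 𝓣.InteriorFace → ℝ) (i : Fin d) (v : 𝓣.PiecewiseSpace) :
    𝓣.DGSpace r :=
  Classical.epsilon (IsPartialPlus γ i v)

/-- The central discrete derivative
`∂_{h,x_i} v = (∂_{h,x_i}^- v + ∂_{h,x_i}^+ v) / 2 ∈ V_r^h`. -/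
def partialCentral (r : ℕ) (γminus γplus : 𝓣.InteriorFace → ℝ) (i : Fin d)
    (v : 𝓣.PiecewiseSpace) : 𝓣.DGSpace r :=
  (1 / 2 : ℝ) • (partialMinus r γminus i v + partialPlus r γplus i v)

/-- The delta function of strength `g` on an interior face, applied to `φ_h ∈ V_r^h`:
`∫_e g {φ_h} ds`. -/
def deltaDG (e : 𝓣.InteriorFace) (g : Euc d → ℝ) (φ : 𝓣.DGSpace r) : ℝ :=
  ∫ x in e.carrier, g x * average (DGSpace.toFun φ) e x ∂(surface d)

end Mesh

end DGCalculus

end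

/-!
Everything follows from piecewise integration by parts (`Mesh.brokenInner_lineDeriv`): summing the
Gauss–Green formula over the cells turns `(v, ∂_{x_i} φ)_{𝓣}` into `-(∂_{x_i} v, φ)_{𝓣}` plus
integrals of `[v φ]` over the interior faces and of `v φ` over the boundary faces.

* The Gauss–Green formula on one polytope (`Polytope.integral_mul_lineDeriv`) concerns a function
  `f` that is only continuous up to the boundary and weakly differentiable inside. The weak
  derivative is tested against `φ χ_ε`, where `χ_ε` is a product of smooth ramps in the variables
  `(c - ⟪n, x⟫) / ε`, one for each bounding half-space `⟪n, x⟫ ≤ c`. The derivative of `χ_ε` lives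
  in layers of width of order `ε` along the bounding hyperplanes. By Cavalieri's principle
  (`integral_slab`) and dominated convergence, the layer of a half-space tends to the integral over
  its facet (`Polytope.tendsto_integral_layer`), because distinct hyperplanes meet in a set without
  surface measure.

* The facets of the cells are matched with the faces of the mesh pointwise, at almost every point
  (`Mesh.IsGeneric.sum_cellFlux`). A generic point of a facet of `K` lies on no other hyperplane, so
  `K` is a half-space near it. Hence any second cell through the point is the opposite half-space,
  a third one is impossible, and the two together are a neighbourhood; as `Ω` is the interior of
  its closure, the point then belongs to `Ω`. Otherwise the point lies on a boundary face.

* Test functions on `Ω` vanish on the boundary faces and do not jump, which gives the formula for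
  the distributional derivative (`Mesh.distDeriv_eq`). The piecewise `L²` inner product is positive
  definite on the finite-dimensional space `V_r^h`, so that linear functionals are represented
  uniquely (`Mesh.DGSpace.existsUnique_brokenInner_eq`). For the central derivative, the mean of the
  two one-sided traces is the average `{v}`, the boundary terms cancel, and
  `[v φ] = {v} [φ] + [v] {φ}` leaves the face integrals of `[v] {φ}` (`Mesh.dgFunctional_add`).
-/

namespace DGCalculus

open Filter Topology Set

/-! ### Hyperplanes and Cavalieri's principle -/

/-- The hyperplane `⟪a.1, x⟫ = a.2`. -/
def hyperplane {d : ℕ} (a : Euc d × ℝ) : Set (Euc d) := {x | inner ℝ a.1 x = a.2}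

theorem isClosed_hyperplane {d : ℕ} (a : Euc d × ℝ) : IsClosed (hyperplane a) :=
  isClosed_eq (by fun_prop) continuous_const

theorem measurableSet_hyperplane {d : ℕ} (a : Euc d × ℝ) : MeasurableSet (hyperplane a) :=
  (isClosed_hyperplane a).measurableSet

section Slab

variable {d : ℕ} {a : Euc d × ℝ}

/-- The isometric parametrisation of a hyperplane by the orthogonal complement of its normal. -/
def hyperplaneParam (a : Euc d × ℝ) (w : (Submodule.span ℝ {a.1})ᗮ) : Euc d := w + a.2 • a.1

theorem isometry_hyperplaneParam (a : Euc d × ℝ) : Isometry (hyperplaneParam a) :=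
  Isometry.of_dist_eq fun x y => by simp [hyperplaneParam, Subtype.dist_eq]

theorem range_hyperplaneParam (ha : ‖a.1‖ = 1) : range (hyperplaneParam a) = hyperplane a := by
  have h1 : inner ℝ a.1 a.1 = (1 : ℝ) := by simp [ha]
  ext x
  constructor
  · rintro ⟨w, rfl⟩
    have := Submodule.mem_orthogonal_singleton_iff_inner_right.1 w.2
    simp [hyperplaneParam, hyperplane, inner_add_right, inner_smul_right, this, ha]
  · intro hx
    have hx : inner ℝ a.1 x = a.2 := hx
    refine ⟨⟨x - a.2 • a.1, ?_⟩, by simp [hyperplaneParam]⟩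
    rw [Submodule.mem_orthogonal_singleton_iff_inner_right, inner_sub_right, inner_smul_right, h1,
      hx]
    ring

theorem map_hyperplaneParam (ha : ‖a.1‖ = 1) :
    (volume : Measure (Submodule.span ℝ {a.1})ᗮ).map (hyperplaneParam a) =
      (surface d).restrict (hyperplane a) := by
  have ha0 : a.1 ≠ 0 := fun h => by simp [h] at ha
  have hr : Module.finrank ℝ (Submodule.span ℝ {a.1})ᗮ = d - 1 := by
    have h := (Submodule.span ℝ {a.1}).finrank_add_finrank_orthogonal
    rw [finrank_span_singleton ha0, finrank_euclideanSpace_fin] at h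
    omega
  rw [← InnerProductSpace.euclideanHausdorffMeasure_eq_volume, hr,
    (isometry_hyperplaneParam a).map_euclideanHausdorffMeasure, range_hyperplaneParam ha]

theorem surface_hyperplane_inter_lt_top (ha : ‖a.1‖ = 1) {s : Set (Euc d)}
    (hs : Bornology.IsBounded s) : surface d (hyperplane a ∩ s) < ⊤ := by
  have hm := (isometry_hyperplaneParam a).continuous.measurable
  have h : surface d (hyperplane a ∩ closure s) < ⊤ := by
    rw [inter_comm, ← Measure.restrict_apply isClosed_closure.measurableSet,
      ← map_hyperplaneParam ha, Measure.map_apply hm isClosed_closure.measurableSet]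
    exact ((isometry_hyperplaneParam a).antilipschitz.isBounded_preimage
      hs.closure).measure_lt_top
  exact (measure_mono (inter_subset_inter_right _ subset_closure)).trans_lt h

theorem sFinite_surface_restrict (ha : ‖a.1‖ = 1) :
    SFinite ((surface d).restrict (hyperplane a)) := by
  rw [← map_hyperplaneParam ha]; infer_instance

/-- Cavalieri's principle: translating a hyperplane along its unit normal sweeps out Lebesgue
measure. -/
theorem measurePreserving_slab (ha : ‖a.1‖ = 1) :
    MeasurePreserving (fun p : ℝ × Euc d => p.2 - p.1 • a.1)
      ((volume : Measure ℝ).prod ((surface d).restrict (hyperplane a))) volume := by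
  have hm := (isometry_hyperplaneParam a).continuous.measurable
  refine ⟨by fun_prop, ?_⟩
  rw [← map_hyperplaneParam ha]
  conv_lhs => rw [← Measure.map_id (μ := (volume : Measure ℝ))]
  rw [Measure.map_prod_map _ _ measurable_id hm, Measure.map_map (by fun_prop)
    (measurable_id.prodMap hm)]
  have e1 : MeasurePreserving (LinearIsometryEquiv.toSpanUnitSingleton (𝕜 := ℝ) a.1 ha) :=
    LinearIsometryEquiv.measurePreserving _
  have e2 := e1.comp (Measure.measurePreserving_neg (volume : Measure ℝ))
  have e3 := e2.prod (MeasurePreserving.id (volume : Measure (Submodule.span ℝ {a.1})ᗮ))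
  have e4 := ((Submodule.span ℝ {a.1}).measurePreserving_measurableEquivProd (a.2 • a.1)).symm
  have e5 := (e4.comp e3).map_eq
  rw [InnerProductSpace.euclideanHausdorffMeasure_eq_volume] at e5
  convert! e5 using 2
  ext1 ⟨s, w⟩
  simp [hyperplaneParam, LinearIsometryEquiv.toSpanUnitSingleton]
  abel

/-- Cavalieri's principle at scale `ε`. -/
theorem integral_slab (ha : ‖a.1‖ = 1) {ε : ℝ} (hε : 0 < ε) (G : Euc d → ℝ)
    (hG : AEStronglyMeasurable G) :
    ∫ x, ε⁻¹ * G x =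
      ∫ p, G (p.2 - (ε * p.1) • a.1)
        ∂((volume : Measure ℝ).prod ((surface d).restrict (hyperplane a))) := by
  have := sFinite_surface_restrict ha
  have hs : (volume : Measure ℝ).map (fun s => ε * s) = ENNReal.ofReal ε⁻¹ • volume := by
    rw [Real.map_volume_mul_left hε.ne', abs_of_pos (by positivity)]
  have h2 : ((volume : Measure ℝ).prod ((surface d).restrict (hyperplane a))).map
      (Prod.map (fun s => ε * s) id) = ENNReal.ofReal ε⁻¹ •
        ((volume : Measure ℝ).prod ((surface d).restrict (hyperplane a))) := by
    rw [← Measure.map_prod_map _ _ (by fun_prop) measurable_id, hs, Measure.map_id,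
      Measure.prod_smul_left]
  have hm : AEStronglyMeasurable (fun p : ℝ × Euc d => G (p.2 - p.1 • a.1))
      ((volume : Measure ℝ).prod ((surface d).restrict (hyperplane a))) :=
    hG.comp_measurePreserving (measurePreserving_slab ha)
  have h3 := integral_map (μ := (volume : Measure ℝ).prod ((surface d).restrict (hyperplane a)))
    (φ := Prod.map (fun s => ε * s) id) (by fun_prop)
    (f := fun p : ℝ × Euc d => G (p.2 - p.1 • a.1)) (by rw [h2]; exact hm.smul_measure _)
  rw [h2, integral_smul_measure] at h3
  simp only [Prod.map_fst, Prod.map_snd, id] at h3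
  rw [← h3, integral_const_mul, ENNReal.toReal_ofReal (by positivity), smul_eq_mul]
  congr 1
  rw [← (measurePreserving_slab ha).map_eq]
  exact integral_map (by fun_prop) (by rwa [(measurePreserving_slab ha).map_eq])

end Slab

/-- Distinct hyperplanes meet in a set without surface measure. -/
theorem surface_hyperplane_inter_hyperplane {d : ℕ} {a b : Euc d × ℝ} (ha : ‖a.1‖ = 1)
    (hb : ‖b.1‖ = 1) (hab : b ≠ a) (hab' : b ≠ -a) :
    surface d (hyperplane a ∩ hyperplane b) = 0 := by
  have hm := (isometry_hyperplaneParam a).continuous.measurable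
  rw [inter_comm, ← Measure.restrict_apply (measurableSet_hyperplane b),
    ← map_hyperplaneParam ha, Measure.map_apply hm (measurableSet_hyperplane b)]
  rcases eq_empty_or_nonempty (hyperplaneParam a ⁻¹' hyperplane b) with he | ⟨w₀, hw₀⟩
  · simp [he]
  let L : (Submodule.span ℝ {a.1})ᗮ →ₗ[ℝ] ℝ :=
    (innerSL ℝ b.1).toLinearMap ∘ₗ (Submodule.span ℝ {a.1})ᗮ.subtype
  have hL : ∀ w, L w = inner ℝ b.1 (w : Euc d) := fun w => rfl
  have hw₀' : inner ℝ b.1 (w₀ : Euc d) + a.2 * inner ℝ b.1 a.1 = b.2 := by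
    simpa [hyperplaneParam, hyperplane, inner_add_right, inner_smul_right] using hw₀
  have hker : LinearMap.ker L ≠ ⊤ := by
    intro h
    have hspan : b.1 ∈ Submodule.span ℝ {a.1} := by
      rw [← Submodule.orthogonal_orthogonal (Submodule.span ℝ {a.1})]
      refine (Submodule.mem_orthogonal' _ _).2 fun w hw => ?_
      have : (⟨w, hw⟩ : (Submodule.span ℝ {a.1})ᗮ) ∈ LinearMap.ker L := h ▸ Submodule.mem_top
      exact this
    obtain ⟨t, ht⟩ := Submodule.mem_span_singleton.1 hspan
    have hw : inner ℝ b.1 (w₀ : Euc d) = 0 := by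
      have : w₀ ∈ LinearMap.ker L := h ▸ Submodule.mem_top
      exact this
    have hta : |t| = 1 := by
      have := hb
      rwa [← ht, norm_smul, ha, mul_one, Real.norm_eq_abs] at this
    have hin : inner ℝ b.1 a.1 = t := by
      rw [← ht, inner_smul_left, real_inner_self_eq_norm_sq, ha]; simp
    rw [hw, hin] at hw₀'
    rcases eq_or_eq_neg_of_abs_eq hta with h1 | h1
    · refine hab (Prod.ext ?_ ?_)
      · rw [← ht, h1, one_smul]
      · rw [← hw₀', h1]; ring
    · refine hab' (Prod.ext ?_ ?_)
      · rw [← ht, h1, neg_one_smul]; rfl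
      · rw [← hw₀', h1]; simp
  refine measure_mono_null (t := (AffineSubspace.mk' w₀ (LinearMap.ker L) : Set _)) ?_
    (Measure.addHaar_affineSubspace _ _ fun h => hker ?_)
  · intro w hw
    have hw' : inner ℝ b.1 (w : Euc d) + a.2 * inner ℝ b.1 a.1 = b.2 := by
      simpa [hyperplaneParam, hyperplane, inner_add_right, inner_smul_right] using hw
    simp only [SetLike.mem_coe, AffineSubspace.mem_mk', LinearMap.mem_ker, vsub_eq_sub]
    rw [map_sub, hL, hL]
    linarith
  · rw [← AffineSubspace.direction_mk' w₀ (LinearMap.ker L), h, AffineSubspace.direction_top]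

/-! ### Smooth cut-off functions of a polytope -/

/-- A smooth function on `ℝ` that vanishes on `(-∞, 1]` and equals `1` on `[2, ∞)`. -/
noncomputable def ramp (t : ℝ) : ℝ := Real.smoothTransition (t - 1)

theorem contDiff_ramp {n : ℕ∞} : ContDiff ℝ n ramp :=
  Real.smoothTransition.contDiff.comp (contDiff_id.sub contDiff_const)

theorem ramp_eq_zero {t : ℝ} (ht : t ≤ 1) : ramp t = 0 :=
  Real.smoothTransition.zero_of_nonpos (by linarith)

theorem ramp_eq_one {t : ℝ} (ht : 2 ≤ t) : ramp t = 1 :=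
  Real.smoothTransition.one_of_one_le (by linarith)

theorem ramp_nonneg (t : ℝ) : 0 ≤ ramp t := Real.smoothTransition.nonneg _

theorem ramp_le_one (t : ℝ) : ramp t ≤ 1 := Real.smoothTransition.le_one _

theorem continuous_ramp : Continuous ramp := (contDiff_ramp (n := 0)).continuous

theorem hasDerivAt_ramp (t : ℝ) : HasDerivAt ramp (deriv ramp t) t :=
  ((contDiff_ramp (n := 1)).differentiable (by simp) t).hasDerivAt

theorem continuous_deriv_ramp : Continuous (deriv ramp) :=
  (contDiff_ramp (n := 1)).continuous_deriv (by simp)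

theorem deriv_ramp_eq_zero {t : ℝ} (ht : t ∉ Icc 1 2) : deriv ramp t = 0 := by
  rw [mem_Icc, not_and_or, not_le, not_le] at ht
  rcases ht with h | h
  · have : ramp =ᶠ[𝓝 t] fun _ => 0 :=
      (eventually_lt_nhds h).mono fun s hs => ramp_eq_zero hs.le
    simpa using this.deriv_eq
  · have : ramp =ᶠ[𝓝 t] fun _ => 1 :=
      (eventually_gt_nhds h).mono fun s hs => ramp_eq_one hs.le
    simpa using this.deriv_eq

theorem hasCompactSupport_deriv_ramp : HasCompactSupport (deriv ramp) :=
  HasCompactSupport.intro isCompact_Icc fun _ => deriv_ramp_eq_zero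

theorem integral_deriv_ramp : ∫ t, deriv ramp t = 1 := by
  have h := integral_of_hasDerivAt_of_tendsto hasDerivAt_ramp
    (continuous_deriv_ramp.integrable_of_hasCompactSupport hasCompactSupport_deriv_ramp)
    (m := 0) (n := 1)
    (tendsto_const_nhds.congr' ((eventually_le_atBot 1).mono fun t ht => (ramp_eq_zero ht).symm))
    (tendsto_const_nhds.congr' ((eventually_ge_atTop 2).mono fun t ht => (ramp_eq_one ht).symm))
  simpa using h

/-- If `c ε` has a positive limit, then `ramp (c ε / ε)` is eventually `1`. -/
theorem tendsto_ramp_div {c : ℝ → ℝ} {c₀ : ℝ} (hc : Tendsto c (𝓝[>] 0) (𝓝 c₀)) (h₀ : 0 < c₀) :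
    ∀ᶠ ε in 𝓝[>] 0, ramp (c ε / ε) = 1 := by
  have h := hc.pos_mul_atTop h₀ (tendsto_inv_nhdsGT_zero (𝕜 := ℝ))
  filter_upwards [h.eventually_ge_atTop 2] with ε hε
  exact ramp_eq_one (by rwa [div_eq_mul_inv])

namespace Polytope

variable {d : ℕ} (K : Polytope d)

theorem interior_carrier : interior K.carrier = {x | ∀ a ∈ K.halfSpaces, inner ℝ a.1 x < a.2} := by
  apply Subset.antisymm
  · intro x hx a ha
    have hxa : inner ℝ a.1 x ≤ a.2 := interior_subset hx a ha
    refine lt_of_le_of_ne hxa fun he => ?_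
    have hc : Tendsto (fun t : ℝ => x + t • a.1) (𝓝[>] 0) (𝓝 x) := by
      have : Continuous fun t : ℝ => x + t • a.1 := by fun_prop
      simpa using (this.tendsto 0).mono_left nhdsWithin_le_nhds
    obtain ⟨t, ht, ht0⟩ := ((hc.eventually (mem_interior_iff_mem_nhds.1 hx)).and
      self_mem_nhdsWithin).exists
    have := ht a ha
    rw [inner_add_right, inner_smul_right, real_inner_self_eq_norm_sq, K.norm_eq_one a ha,
      he] at this
    have ht0 : 0 < t := ht0
    linarith
  · have : {x : Euc d | ∀ a ∈ K.halfSpaces, inner ℝ a.1 x < a.2} =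
        ⋂ a ∈ K.halfSpaces, {x : Euc d | inner ℝ a.1 x < a.2} := by ext; simp
    refine interior_maximal (fun x hx a ha => (hx a ha).le) ?_
    rw [this]
    exact isOpen_biInter_finset fun a _ => isOpen_lt (by fun_prop) continuous_const

theorem isCompact_carrier : IsCompact K.carrier :=
  Metric.isCompact_of_isClosed_isBounded K.isClosed_carrier K.isBounded

theorem neg_notMem_halfSpaces {a : Euc d × ℝ} (ha : a ∈ K.halfSpaces) : -a ∉ K.halfSpaces := by
  intro hb
  obtain ⟨x, hx⟩ : (interior K.carrier).Nonempty := K.nonempty_interior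
  rw [interior_carrier] at hx
  have h1 := hx a ha
  have h2 := hx _ hb
  simp only [Prod.fst_neg, Prod.snd_neg, inner_neg_left] at h2
  linarith

theorem isClosed_facet (a : Euc d × ℝ) : IsClosed (K.facet a) :=
  K.isClosed_carrier.inter (isClosed_hyperplane a)

theorem surface_facet_lt_top {a : Euc d × ℝ} (ha : a ∈ K.halfSpaces) :
    surface d (K.facet a) < ⊤ := by
  have := surface_hyperplane_inter_lt_top (K.norm_eq_one a ha) K.isBounded
  rwa [inter_comm] at this

/-- A smooth function with compact support in the interior of `K`, for `ε > 0`, and equal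
to `1` at the points of `K` whose distance from all bounding hyperplanes is at least `2 ε`. -/
noncomputable def cutoff (ε : ℝ) (x : Euc d) : ℝ :=
  ∏ a ∈ K.halfSpaces, ramp ((a.2 - inner ℝ a.1 x) / ε)

theorem contDiff_cutoff (ε : ℝ) {n : ℕ∞} : ContDiff ℝ n (K.cutoff ε) := by
  unfold cutoff
  exact contDiff_prod fun a _ => contDiff_ramp.comp
    ((contDiff_const.sub (innerSL ℝ a.1).contDiff).div_const ε)

theorem cutoff_nonneg (ε : ℝ) (x : Euc d) : 0 ≤ K.cutoff ε x :=
  Finset.prod_nonneg fun _ _ => ramp_nonneg _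

theorem cutoff_le_one (ε : ℝ) (x : Euc d) : K.cutoff ε x ≤ 1 :=
  Finset.prod_le_one (fun _ _ => ramp_nonneg _) fun _ _ => ramp_le_one _

theorem tsupport_cutoff_subset {ε : ℝ} (hε : 0 < ε) :
    tsupport (K.cutoff ε) ⊆ interior K.carrier := by
  have h1 : IsClosed {x : Euc d | ∀ a ∈ K.halfSpaces, inner ℝ a.1 x + ε ≤ a.2} := by
    have : {x : Euc d | ∀ a ∈ K.halfSpaces, inner ℝ a.1 x + ε ≤ a.2} =
        ⋂ a ∈ K.halfSpaces, {x : Euc d | inner ℝ a.1 x + ε ≤ a.2} := by ext; simp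
    rw [this]
    exact isClosed_biInter fun a _ => isClosed_le (by fun_prop) continuous_const
  refine (closure_minimal ?_ h1).trans ?_
  · intro x hx a ha
    by_contra! hlt
    refine hx (Finset.prod_eq_zero ha (ramp_eq_zero ?_))
    rw [div_le_one hε]; linarith
  · rw [interior_carrier]
    intro x hx a ha
    linarith [hx a ha]

theorem hasCompactSupport_cutoff {ε : ℝ} (hε : 0 < ε) : HasCompactSupport (K.cutoff ε) :=
  K.isCompact_carrier.of_isClosed_subset (isClosed_tsupport _)
    ((K.tsupport_cutoff_subset hε).trans interior_subset)

theorem tendsto_cutoff {x : Euc d} (hx : x ∈ interior K.carrier) :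
    Tendsto (fun ε => K.cutoff ε x) (𝓝[>] 0) (𝓝 1) := by
  rw [interior_carrier] at hx
  have : ∀ᶠ ε in 𝓝[>] (0 : ℝ), ∀ a ∈ K.halfSpaces, ramp ((a.2 - inner ℝ a.1 x) / ε) = 1 :=
    (eventually_all_finset _).2 fun a ha =>
      tendsto_ramp_div tendsto_const_nhds (sub_pos.2 (hx a ha))
  exact tendsto_const_nhds.congr' (this.mono fun ε hε => (Finset.prod_eq_one hε).symm)

theorem hasFDerivAt_cutoff (ε : ℝ) (x : Euc d) :
    HasFDerivAt (K.cutoff ε) (∑ a ∈ K.halfSpaces,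
      (∏ b ∈ K.halfSpaces.erase a, ramp ((b.2 - inner ℝ b.1 x) / ε)) •
        (deriv ramp ((a.2 - inner ℝ a.1 x) / ε) • (-ε⁻¹ • innerSL ℝ a.1))) x := by
  unfold cutoff
  refine HasFDerivAt.finsetProd fun a _ => ?_
  refine (hasDerivAt_ramp _).comp_hasFDerivAt x ?_
  have h := (((innerSL ℝ a.1).hasFDerivAt (x := x)).const_sub a.2).mul_const ε⁻¹
  simpa [div_eq_mul_inv] using h

/-- Integrating against the cut-off functions exhausts the integral over the cell. -/
theorem tendsto_integral_cutoff {G : Euc d → ℝ} (hG : IntegrableOn G K.carrier) :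
    Tendsto (fun ε => ∫ x in K.carrier, G x * K.cutoff ε x) (𝓝[>] 0)
      (𝓝 (∫ x in K.carrier, G x)) := by
  refine tendsto_integral_filter_of_dominated_convergence (fun x => ‖G x‖) ?_ ?_ hG.norm ?_
  · exact .of_forall fun ε => hG.aestronglyMeasurable.mul
      (K.contDiff_cutoff ε (n := 0)).continuous.aestronglyMeasurable
  · refine .of_forall fun ε => .of_forall fun x => ?_
    rw [norm_mul, Real.norm_of_nonneg (K.cutoff_nonneg ε x)]
    exact mul_le_of_le_one_right (norm_nonneg _) (K.cutoff_le_one ε x)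
  · have h0 : ∀ᵐ x, x ∉ frontier K.carrier :=
      measure_eq_zero_iff_ae_notMem.1 (K.convex_carrier.addHaar_frontier volume)
    filter_upwards [ae_restrict_of_ae h0, ae_restrict_mem K.isClosed_carrier.measurableSet]
      with x hx hxK
    have hxi : x ∈ interior K.carrier := by
      by_contra h; exact hx ⟨subset_closure hxK, h⟩
    simpa using (K.tendsto_cutoff hxi).const_mul (G x)

end Polytope

/-! ### The Gauss–Green formula on a polytope -/

namespace Polytope

variable {d : ℕ} (K : Polytope d)

theorem measurable_indicator_carrier {h : Euc d → ℝ} (hh : ContinuousOn h K.carrier) :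
    Measurable (K.carrier.indicator h) := by
  classical
  rw [← piecewise_eq_indicator]
  exact hh.measurable_piecewise continuousOn_const K.isClosed_carrier.measurableSet

/-- Almost every point of the hyperplane of `a` lies on no other bounding hyperplane of `K`. -/
theorem ae_hyperplane_inner_ne {a : Euc d × ℝ} (ha : a ∈ K.halfSpaces) :
    ∀ᵐ x ∂(surface d).restrict (hyperplane a),
      ∀ b ∈ K.halfSpaces.erase a, inner ℝ b.1 x ≠ b.2 := by
  rw [Filter.eventually_all_finset]
  intro b hb
  obtain ⟨hba, hbK⟩ := Finset.mem_erase.1 hb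
  have h0 := surface_hyperplane_inter_hyperplane (K.norm_eq_one a ha) (K.norm_eq_one b hbK) hba
    fun h => K.neg_notMem_halfSpaces ha (h ▸ hbK)
  rw [ae_restrict_iff' (measurableSet_hyperplane a)]
  filter_upwards [measure_eq_zero_iff_ae_notMem.1 h0] with x hx hxa hxb
  exact hx ⟨hxa, hxb⟩

/-- The layer of width `ε` of the cut-off function along the hyperplane of `a` concentrates on
the facet. -/
theorem tendsto_integral_layer {a : Euc d × ℝ} (ha : a ∈ K.halfSpaces) {h : Euc d → ℝ}
    (hh : ContinuousOn h K.carrier) :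
    Tendsto (fun ε => ∫ x, ε⁻¹ * (K.carrier.indicator h x *
        (deriv ramp ((a.2 - inner ℝ a.1 x) / ε) *
          ∏ b ∈ K.halfSpaces.erase a, ramp ((b.2 - inner ℝ b.1 x) / ε))))
      (𝓝[>] 0) (𝓝 (∫ x in K.facet a, h x ∂surface d)) := by
  have ha1 := K.norm_eq_one a ha
  have := sFinite_surface_restrict ha1
  have hmeas := K.measurable_indicator_carrier hh
  have hmr := continuous_ramp.measurable
  have hmd := continuous_deriv_ramp.measurable
  have hmG : ∀ ε : ℝ, Measurable fun x => K.carrier.indicator h x *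
      (deriv ramp ((a.2 - inner ℝ a.1 x) / ε) *
        ∏ b ∈ K.halfSpaces.erase a, ramp ((b.2 - inner ℝ b.1 x) / ε)) := by
    intro ε
    refine hmeas.mul ((hmd.comp (by fun_prop)).mul ?_)
    exact Finset.measurable_fun_prod _ fun b _ => hmr.comp (by fun_prop)
  -- in the coordinates `(s, x) ↦ x - ε s n`, the limit integrand is `ramp' s * 1_facet x * h x`
  have hlim : ∫ p : ℝ × Euc d, deriv ramp p.1 * (K.facet a).indicator h p.2
      ∂((volume : Measure ℝ).prod ((surface d).restrict (hyperplane a))) =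
      ∫ x in K.facet a, h x ∂surface d := by
    rw [integral_prod_mul (deriv ramp) ((K.facet a).indicator h), integral_deriv_ramp, one_mul,
      integral_indicator (K.isClosed_facet a).measurableSet,
      Measure.restrict_restrict (K.isClosed_facet a).measurableSet]
    congr 2
    exact inter_eq_left.2 fun x hx => hx.2
  rw [← hlim]
  have hcongr : ∀ᶠ ε in 𝓝[>] (0 : ℝ), ∫ p : ℝ × Euc d,
      K.carrier.indicator h (p.2 - (ε * p.1) • a.1) *
      (deriv ramp ((a.2 - inner ℝ a.1 (p.2 - (ε * p.1) • a.1)) / ε) *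
        ∏ b ∈ K.halfSpaces.erase a, ramp ((b.2 - inner ℝ b.1 (p.2 - (ε * p.1) • a.1)) / ε))
      ∂((volume : Measure ℝ).prod ((surface d).restrict (hyperplane a))) =
      ∫ x, ε⁻¹ * (K.carrier.indicator h x * (deriv ramp ((a.2 - inner ℝ a.1 x) / ε) *
          ∏ b ∈ K.halfSpaces.erase a, ramp ((b.2 - inner ℝ b.1 x) / ε))) := by
    filter_upwards [self_mem_nhdsWithin] with ε hε
    exact (integral_slab ha1 hε _ (hmG ε).aestronglyMeasurable).symm
  refine Tendsto.congr' hcongr ?_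
  have hmem : ∀ᵐ p : ℝ × Euc d ∂((volume : Measure ℝ).prod ((surface d).restrict (hyperplane a))),
      p.2 ∈ hyperplane a ∧ ∀ b ∈ K.halfSpaces.erase a, inner ℝ b.1 p.2 ≠ b.2 :=
    Measure.quasiMeasurePreserving_snd.ae
      ((ae_restrict_mem (measurableSet_hyperplane a)).and (K.ae_hyperplane_inner_ne ha))
  have hslab : ∀ {ε : ℝ}, 0 < ε → ∀ {s : ℝ} {x : Euc d}, x ∈ hyperplane a →
      (a.2 - inner ℝ a.1 (x - (ε * s) • a.1)) / ε = s := by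
    intro ε hε s x hx
    have hx : inner ℝ a.1 x = a.2 := hx
    rw [inner_sub_right, inner_smul_right, real_inner_self_eq_norm_sq, ha1, hx]
    field_simp
    ring
  obtain ⟨M, hM⟩ := K.isCompact_carrier.exists_bound_of_continuousOn hh
  have hM' : ∀ x, |K.carrier.indicator h x| ≤ |M| := fun x => by
    by_cases hx : x ∈ K.carrier
    · simpa [hx] using (hM x hx).trans (le_abs_self M)
    · simp [hx]
  obtain ⟨R, hR⟩ := K.isBounded.subset_closedBall (0 : Euc d)
  have hprod : ∀ (ε : ℝ) (y : Euc d),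
      |∏ b ∈ K.halfSpaces.erase a, ramp ((b.2 - inner ℝ b.1 y) / ε)| ≤ 1 := fun ε y => by
    rw [abs_of_nonneg (Finset.prod_nonneg fun _ _ => ramp_nonneg _)]
    exact Finset.prod_le_one (fun _ _ => ramp_nonneg _) fun _ _ => ramp_le_one _
  refine tendsto_integral_filter_of_dominated_convergence
    (fun p => |deriv ramp p.1| *
      (Metric.closedBall (0 : Euc d) (R + 2)).indicator (fun _ => |M|) p.2)
    ?_ ?_ ?_ ?_
  · exact .of_forall fun ε => ((hmG ε).comp (g := fun x => K.carrier.indicator h x *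
      (deriv ramp ((a.2 - inner ℝ a.1 x) / ε) *
        ∏ b ∈ K.halfSpaces.erase a, ramp ((b.2 - inner ℝ b.1 x) / ε)))
      (by fun_prop : Measurable fun p : ℝ × Euc d => p.2 - (ε * p.1) • a.1)).aestronglyMeasurable
  · filter_upwards [Ioo_mem_nhdsGT (zero_lt_one' ℝ)] with ε hε
    filter_upwards [hmem] with p hp
    rw [hslab hε.1 hp.1, norm_mul, norm_mul, Real.norm_eq_abs, Real.norm_eq_abs, Real.norm_eq_abs]
    by_cases hs : p.1 ∈ Icc (1 : ℝ) 2
    swap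
    · simp [deriv_ramp_eq_zero hs]
    by_cases hx : p.2 - (ε * p.1) • a.1 ∈ K.carrier
    swap
    · rw [indicator_of_notMem hx, abs_zero, zero_mul]
      exact mul_nonneg (abs_nonneg _) (indicator_nonneg (fun _ _ => abs_nonneg _) _)
    have hball : p.2 ∈ Metric.closedBall (0 : Euc d) (R + 2) := by
      have h1 := hR hx
      rw [mem_closedBall_zero_iff] at h1 ⊢
      calc ‖p.2‖ = ‖(p.2 - (ε * p.1) • a.1) + (ε * p.1) • a.1‖ := by simp
        _ ≤ R + 2 := (norm_add_le _ _).trans (add_le_add h1 ?_)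
      rw [norm_smul, ha1, mul_one, Real.norm_eq_abs,
        abs_of_nonneg (mul_nonneg hε.1.le (by linarith [hs.1]))]
      nlinarith [hε.1, hε.2, hs.1, hs.2]
    rw [indicator_of_mem hball, mul_comm]
    refine mul_le_mul ?_ (hM' _) (abs_nonneg _) (abs_nonneg _)
    exact mul_le_of_le_one_right (abs_nonneg _) (hprod _ _)
  · refine Integrable.mul_prod (f := fun s => |deriv ramp s|)
      (continuous_deriv_ramp.integrable_of_hasCompactSupport hasCompactSupport_deriv_ramp).abs ?_
    rw [integrable_indicator_iff Metric.isClosed_closedBall.measurableSet]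
    refine integrableOn_const (ne_of_lt ?_)
    rw [Measure.restrict_apply Metric.isClosed_closedBall.measurableSet, inter_comm]
    exact surface_hyperplane_inter_lt_top ha1 Metric.isBounded_closedBall
  · filter_upwards [hmem] with p hp
    obtain ⟨s, x⟩ := p
    obtain ⟨hxa, hxne⟩ := hp
    have hxa' : inner ℝ a.1 x = a.2 := hxa
    by_cases hs : s ∈ Icc (1 : ℝ) 2
    swap
    · refine tendsto_const_nhds.congr' ?_
      filter_upwards [self_mem_nhdsWithin] with ε hε
      rw [hslab hε hxa, deriv_ramp_eq_zero hs]; simp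
    have hpath : Tendsto (fun ε : ℝ => x - (ε * s) • a.1) (𝓝[>] 0) (𝓝 x) := by
      have : Continuous fun ε : ℝ => x - (ε * s) • a.1 := by fun_prop
      simpa using (this.tendsto 0).mono_left nhdsWithin_le_nhds
    have hinner : ∀ b : Euc d × ℝ, Tendsto (fun ε : ℝ => b.2 - inner ℝ b.1 (x - (ε * s) • a.1))
        (𝓝[>] 0) (𝓝 (b.2 - inner ℝ b.1 x)) := fun b =>
      ((continuous_const.sub ((innerSL ℝ b.1).continuous)).tendsto x).comp hpath
    by_cases hxK : ∀ b ∈ K.halfSpaces.erase a, inner ℝ b.1 x < b.2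
    · have hxf : x ∈ K.facet a := by
        refine ⟨fun b hb => ?_, hxa'⟩
        by_cases hba : b = a
        · rw [hba, hxa']
        · exact (hxK b (Finset.mem_erase.2 ⟨hba, hb⟩)).le
      have hone : ∀ᶠ ε in 𝓝[>] (0 : ℝ), ∀ b ∈ K.halfSpaces.erase a,
          ramp ((b.2 - inner ℝ b.1 (x - (ε * s) • a.1)) / ε) = 1 :=
        (eventually_all_finset _).2 fun b hb =>
          tendsto_ramp_div (hinner b) (sub_pos.2 (hxK b hb))
      have hin : ∀ᶠ ε in 𝓝[>] (0 : ℝ), ∀ b ∈ K.halfSpaces.erase a,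
          0 < b.2 - inner ℝ b.1 (x - (ε * s) • a.1) :=
        (eventually_all_finset _).2 fun b hb =>
          (hinner b).eventually_const_lt (sub_pos.2 (hxK b hb))
      have hinK : ∀ᶠ ε in 𝓝[>] (0 : ℝ), x - (ε * s) • a.1 ∈ K.carrier := by
        filter_upwards [hin, self_mem_nhdsWithin] with ε hε hε0 b hb
        have hε0 : 0 < ε := hε0
        by_cases hba : b = a
        · have h1 := hslab hε0 (s := s) hxa
          rw [div_eq_iff hε0.ne'] at h1
          rw [hba]
          nlinarith [hs.1]
        · exact (sub_pos.1 (hε b (Finset.mem_erase.2 ⟨hba, hb⟩))).le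
      have hcont : Tendsto (fun ε : ℝ => h (x - (ε * s) • a.1)) (𝓝[>] 0) (𝓝 (h x)) :=
        (hh x hxf.1).tendsto.comp (tendsto_nhdsWithin_iff.2 ⟨hpath, hinK⟩)
      simp only
      rw [indicator_of_mem hxf, mul_comm]
      refine (hcont.mul_const _).congr' ?_
      filter_upwards [hone, hinK, self_mem_nhdsWithin] with ε h1 h2 h3
      rw [hslab h3 hxa, Finset.prod_eq_one h1, indicator_of_mem h2, mul_one]
    · -- beyond another bounding hyperplane the factor of that half-space vanishes
      push Not at hxK
      obtain ⟨b, hb, hbx⟩ := hxK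
      have hbx' : b.2 - inner ℝ b.1 x < 0 :=
        sub_neg.2 (lt_of_le_of_ne hbx (hxne b hb).symm)
      have hxf : x ∉ K.facet a := fun hx =>
        (sub_neg.1 hbx').not_ge (hx.1 b (Finset.mem_erase.1 hb).2)
      simp only
      rw [indicator_of_notMem hxf, mul_zero]
      refine tendsto_const_nhds.congr' ?_
      filter_upwards [(hinner b).eventually_lt_const hbx', self_mem_nhdsWithin] with ε h1 h2
      have : ramp ((b.2 - inner ℝ b.1 (x - (ε * s) • a.1)) / ε) = 0 :=
        ramp_eq_zero ((div_neg_of_neg_of_pos h1 h2).le.trans zero_le_one)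
      rw [Finset.prod_eq_zero hb this]; simp

/-- The smooth function `φ`, cut off so as to be a test function in the interior of the cell. -/
noncomputable def cutoffTest {φ : Euc d → ℝ} (hφ : ContDiff ℝ (⊤ : ℕ∞) φ) {ε : ℝ} (hε : 0 < ε) :
    𝓓(K.inside, ℝ) where
  toFun x := φ x * K.cutoff ε x
  contDiff' := hφ.mul (K.contDiff_cutoff ε)
  hasCompactSupport' := (K.hasCompactSupport_cutoff hε).mul_left
  tsupport_subset' := (tsupport_mul_subset_right).trans (K.tsupport_cutoff_subset hε)

end Polytope

theorem continuous_lineDeriv {d : ℕ} {φ : Euc d → ℝ} (hφ : ContDiff ℝ (⊤ : ℕ∞) φ) (u : Euc d) :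
    Continuous fun x => lineDeriv ℝ φ x u := by
  have h : (fun x => lineDeriv ℝ φ x u) = fun x => fderiv ℝ φ x u := by
    ext x
    exact (hφ.differentiable (by simp) x).lineDeriv_eq_fderiv
  rw [h]
  exact (hφ.continuous_fderiv (by simp)).clm_apply continuous_const

theorem regularDist_apply {d : ℕ} {U : Opens (Euc d)} {f : Euc d → ℝ}
    (hf : LocallyIntegrableOn f U) (φ : 𝓓(U, ℝ)) : regularDist U f φ = ∫ x, φ x * f x :=
  TestFunction.integralAgainstBilinCLM_eq_integral hf

/-- The defining identity of the weak derivative. -/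
theorem IsWeakPartial.integral_eq {d : ℕ} {U : Opens (Euc d)} {i : Fin d} {f g : Euc d → ℝ}
    (hf : IntegrableOn f U) (hg : IsWeakPartial U i f g) (φ : 𝓓(U, ℝ)) :
    ∫ x, lineDeriv ℝ φ x (coordDir i) * f x = -∫ x, φ x * g x := by
  have h := DFunLike.congr_fun hg.2 φ
  rw [Distribution.lineDerivOp_apply_apply, regularDist_apply hg.1.locallyIntegrableOn, map_neg,
    regularDist_apply hf.locallyIntegrableOn] at h
  rw [← h, neg_neg]
  congr 1 with x
  rw [TestFunction.lineDerivOp_eq_lineDerivCLM ℝ, TestFunction.lineDerivCLM_apply_of_le (by simp)]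

namespace Polytope

variable {d : ℕ} (K : Polytope d)

theorem integrableOn_carrier_iff {f : Euc d → ℝ} :
    IntegrableOn f K.carrier ↔ IntegrableOn f (interior K.carrier) := by
  refine integrableOn_congr_set_ae ?_
  exact (interior_ae_eq_of_null_frontier (K.convex_carrier.addHaar_frontier volume)).symm

theorem setIntegral_interior (f : Euc d → ℝ) :
    ∫ x in interior K.carrier, f x = ∫ x in K.carrier, f x :=
  setIntegral_congr_set
    (interior_ae_eq_of_null_frontier (K.convex_carrier.addHaar_frontier volume))

/-- The Gauss–Green formula on a polytope. -/
theorem integral_mul_lineDeriv {i : Fin d} {f g φ : Euc d → ℝ} (hf : ContinuousOn f K.carrier)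
    (hg : IsWeakPartial K.inside i f g) (hφ : ContDiff ℝ (⊤ : ℕ∞) φ) :
    ∫ x in K.carrier, f x * lineDeriv ℝ φ x (coordDir i) =
      ∑ a ∈ K.halfSpaces, a.1 i * ∫ x in K.facet a, f x * φ x ∂surface d
        - ∫ x in K.carrier, g x * φ x := by
  have hφ1 : Continuous fun x => lineDeriv ℝ φ x (coordDir i) := continuous_lineDeriv hφ _
  have hfi : IntegrableOn f K.carrier := hf.integrableOn_compact K.isCompact_carrier
  have hgi : IntegrableOn g K.carrier := K.integrableOn_carrier_iff.2 hg.1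
  have hgφ : IntegrableOn (fun x => g x * φ x) K.carrier :=
    hgi.mul_continuousOn hφ.continuous.continuousOn K.isCompact_carrier
  have hfφ' : IntegrableOn (fun x => f x * lineDeriv ℝ φ x (coordDir i)) K.carrier :=
    (hf.mul hφ1.continuousOn).integrableOn_compact K.isCompact_carrier
  have hfφ : ContinuousOn (fun x => f x * φ x) K.carrier := hf.mul hφ.continuous.continuousOn
  have hL := tendsto_finsetSum K.halfSpaces fun a ha =>
    (K.tendsto_integral_layer ha hfφ).const_mul (a.1 i)
  have hT := (hL.sub (K.tendsto_integral_cutoff hgφ))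
  refine tendsto_nhds_unique (K.tendsto_integral_cutoff hfφ') (hT.congr' ?_)
  filter_upwards [self_mem_nhdsWithin] with ε hε
  have hε : 0 < ε := hε
  have hw := hg.integral_eq (K.integrableOn_carrier_iff.1 hfi) (K.cutoffTest hφ hε)
  have hzero : ∀ x, x ∉ K.carrier → K.cutoff ε x = 0 := fun x hx =>
    image_eq_zero_of_notMem_tsupport fun h => hx (interior_subset (K.tsupport_cutoff_subset hε h))
  have hcoe : ∀ x, K.cutoffTest hφ hε x = φ x * K.cutoff ε x := fun x => rfl
  have hderiv : ∀ x, lineDeriv ℝ (K.cutoffTest hφ hε) x (coordDir i) =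
      lineDeriv ℝ φ x (coordDir i) * K.cutoff ε x - ∑ a ∈ K.halfSpaces, a.1 i * (ε⁻¹ * (φ x *
        (deriv ramp ((a.2 - inner ℝ a.1 x) / ε) *
          ∏ b ∈ K.halfSpaces.erase a, ramp ((b.2 - inner ℝ b.1 x) / ε)))) := by
    intro x
    have hd := (hφ.differentiable (by simp) x)
    have h1 := hd.hasFDerivAt.mul (K.hasFDerivAt_cutoff ε x)
    have h2 := (h1.hasLineDerivAt (coordDir i)).lineDeriv
    have hin : ∀ a : Euc d × ℝ, inner ℝ a.1 (coordDir i) = a.1 i := fun a => by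
      simp [coordDir, EuclideanSpace.inner_single_right]
    rw [hd.lineDeriv_eq_fderiv]
    refine Eq.trans h2 ?_
    simp only [add_apply, smul_apply,
      sum_apply, innerSL_apply_apply, hin, smul_eq_mul, Finset.mul_sum]
    rw [add_comm, mul_comm, sub_eq_add_neg, ← Finset.sum_neg_distrib]
    congr 1
    refine Finset.sum_congr rfl fun a _ => ?_
    ring
  have hout : ∀ x, x ∉ K.carrier → lineDeriv ℝ (K.cutoffTest hφ hε) x (coordDir i) = 0 := by
    intro x hx
    have h0 : (K.cutoffTest hφ hε : Euc d → ℝ) =ᶠ[𝓝 x] fun _ => 0 :=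
      notMem_tsupport_iff_eventuallyEq.1 fun h =>
        hx (interior_subset ((K.cutoffTest hφ hε).tsupport_subset h))
    rw [h0.lineDeriv_eq]
    simp [lineDeriv]
  have hsplit : ∀ x, lineDeriv ℝ (K.cutoffTest hφ hε) x (coordDir i) * f x =
      K.carrier.indicator (fun x => f x * lineDeriv ℝ φ x (coordDir i) * K.cutoff ε x) x
      - ∑ a ∈ K.halfSpaces, K.carrier.indicator (fun x => a.1 i * (ε⁻¹ * (f x * φ x *
        (deriv ramp ((a.2 - inner ℝ a.1 x) / ε) *
          ∏ b ∈ K.halfSpaces.erase a, ramp ((b.2 - inner ℝ b.1 x) / ε))))) x := by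
    intro x
    by_cases hx : x ∈ K.carrier
    · simp only [indicator_of_mem hx]
      rw [hderiv, sub_mul, Finset.sum_mul]
      congr 1
      · ring
      · exact Finset.sum_congr rfl fun a _ => by ring
    · simp [hx, hout x hx]
  have hcutc : Continuous (K.cutoff ε) := (K.contDiff_cutoff ε (n := 0)).continuous
  have hi1 : Integrable
      (K.carrier.indicator fun x => f x * lineDeriv ℝ φ x (coordDir i) * K.cutoff ε x) := by
    rw [integrable_indicator_iff K.isClosed_carrier.measurableSet]
    exact hfφ'.mul_continuousOn hcutc.continuousOn K.isCompact_carrier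
  have hi2 : ∀ a ∈ K.halfSpaces, Integrable
      (K.carrier.indicator (fun x => a.1 i * (ε⁻¹ * (f x * φ x *
        (deriv ramp ((a.2 - inner ℝ a.1 x) / ε) *
          ∏ b ∈ K.halfSpaces.erase a, ramp ((b.2 - inner ℝ b.1 x) / ε)))))) := by
    intro a _
    rw [integrable_indicator_iff K.isClosed_carrier.measurableSet]
    have hc : Continuous fun x : Euc d => deriv ramp ((a.2 - inner ℝ a.1 x) / ε) *
        ∏ b ∈ K.halfSpaces.erase a, ramp ((b.2 - inner ℝ b.1 x) / ε) :=
      (continuous_deriv_ramp.comp (by fun_prop)).mul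
        (continuous_finsetProd _ fun b _ => continuous_ramp.comp (by fun_prop))
    have h3 : IntegrableOn (fun x => f x * φ x * (deriv ramp ((a.2 - inner ℝ a.1 x) / ε) *
        ∏ b ∈ K.halfSpaces.erase a, ramp ((b.2 - inner ℝ b.1 x) / ε))) K.carrier :=
      (hfφ.mul hc.continuousOn).integrableOn_compact K.isCompact_carrier
    exact (h3.const_mul _).const_mul _
  simp only [hsplit] at hw
  rw [integral_sub hi1 (integrable_finsetSum _ hi2), integral_finsetSum _ hi2,
    integral_indicator K.isClosed_carrier.measurableSet] at hw
  have hg2 : ∫ x, K.cutoffTest hφ hε x * g x = ∫ x in K.carrier, g x * φ x * K.cutoff ε x := by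
    rw [← integral_indicator K.isClosed_carrier.measurableSet]
    congr 1 with x
    by_cases hx : x ∈ K.carrier
    · rw [indicator_of_mem hx, hcoe]; ring
    · rw [indicator_of_notMem hx, hcoe, hzero x hx]; ring
  rw [hg2] at hw
  rw [sub_eq_iff_eq_add, ← sub_eq_iff_eq_add', sub_eq_iff_eq_add] at hw
  have hsum : ∑ a ∈ K.halfSpaces, ∫ x, K.carrier.indicator (fun x => a.1 i * (ε⁻¹ * (f x * φ x *
        (deriv ramp ((a.2 - inner ℝ a.1 x) / ε) *
          ∏ b ∈ K.halfSpaces.erase a, ramp ((b.2 - inner ℝ b.1 x) / ε))))) x =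
      ∑ a ∈ K.halfSpaces, a.1 i * ∫ x, ε⁻¹ * (K.carrier.indicator (fun x => f x * φ x) x *
        (deriv ramp ((a.2 - inner ℝ a.1 x) / ε) *
          ∏ b ∈ K.halfSpaces.erase a, ramp ((b.2 - inner ℝ b.1 x) / ε))) := by
    refine Finset.sum_congr rfl fun a _ => ?_
    rw [← integral_const_mul]
    congr 1 with x
    by_cases hx : x ∈ K.carrier <;> simp [hx]
  rw [← hsum]
  linarith

end Polytope

/-! ### Generic points of the facets -/

namespace Polytope

variable {d : ℕ} (K : Polytope d)

theorem carrier_subset_closure_interior : K.carrier ⊆ closure (interior K.carrier) := by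
  rw [K.convex_carrier.closure_interior_eq_closure_of_nonempty_interior K.nonempty_interior]
  exact subset_closure

theorem frontier_carrier : frontier K.carrier = ⋃ a ∈ K.halfSpaces, K.facet a := by
  ext x
  rw [K.isClosed_carrier.frontier_eq, interior_carrier]
  simp only [mem_iUnion, exists_prop]
  constructor
  · rintro ⟨hx, hxi⟩
    obtain ⟨a, ha, hax⟩ : ∃ a ∈ K.halfSpaces, a.2 ≤ inner ℝ a.1 x := by
      by_contra! h
      exact hxi h
    exact ⟨a, ha, hx, le_antisymm (hx a ha) hax⟩
  · rintro ⟨a, ha, hx, hax⟩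
    exact ⟨hx, fun h => (h a ha).ne hax⟩

theorem surface_frontier_lt_top : surface d (frontier K.carrier) < ⊤ := by
  rw [frontier_carrier]
  exact measure_biUnion_lt_top K.halfSpaces.finite_toSet fun _ ha => K.surface_facet_lt_top ha

/-- Near a point that lies on a single bounding hyperplane, a polytope is a half-space. -/
theorem eventually_mem_carrier_iff {a : Euc d × ℝ} {x : Euc d} (hx : x ∈ K.carrier)
    (ha : a ∈ K.halfSpaces) (h : ∀ b ∈ K.halfSpaces, inner ℝ b.1 x = b.2 → b = a) :
    ∀ᶠ y in 𝓝 x, y ∈ K.carrier ↔ inner ℝ a.1 y ≤ a.2 := by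
  have h1 : ∀ᶠ y in 𝓝 x, ∀ b ∈ K.halfSpaces, b ≠ a → inner ℝ b.1 y < b.2 := by
    rw [Filter.eventually_all_finset]
    intro b hb
    by_cases hba : b = a
    · exact .of_forall fun y hy => absurd hba hy
    · have hlt : inner ℝ b.1 x < b.2 := lt_of_le_of_ne (hx b hb) fun he => hba (h b hb he)
      have hc : Continuous fun y : Euc d => inner ℝ b.1 y := by fun_prop
      exact ((hc.tendsto x).eventually_lt_const hlt).mono fun y hy _ => hy
  filter_upwards [h1] with y hy
  refine ⟨fun hyK => hyK a ha, fun hya b hb => ?_⟩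
  by_cases hba : b = a
  · rwa [hba]
  · exact (hy b hb hba).le

end Polytope

/-- Continuous functions on compact sets of finite surface measure are integrable. -/
theorem integrableOn_surface {d : ℕ} {s : Set (Euc d)} {f : Euc d → ℝ} (hs : IsCompact s)
    (hμ : surface d s < ⊤) (hf : ContinuousOn f s) : IntegrableOn f s (surface d) := by
  obtain ⟨C, hC⟩ := hs.exists_bound_of_continuousOn hf
  exact (integrableOn_const hμ.ne).mono' (g := fun _ => C)
    (hf.aestronglyMeasurable hs.measurableSet) (ae_restrict_of_forall_mem hs.measurableSet hC)

namespace Mesh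

variable {d : ℕ} {Ω : Opens (Euc d)} (𝓣 : Mesh Ω)

/-- A point that lies on at most one of the bounding hyperplanes of the cells (hyperplanes being
counted without orientation), and on none of those intersections of the boundaries of two cells, or
of a facet with the boundary of `Ω`, that have surface measure zero. -/
structure IsGeneric (x : Euc d) : Prop where
  eq_or_eq_neg : ∀ k l, ∀ a ∈ (𝓣.cell k).halfSpaces, ∀ b ∈ (𝓣.cell l).halfSpaces,
    x ∈ hyperplane a → x ∈ hyperplane b → b = a ∨ b = -a
  surface_frontier_pos : ∀ k l, x ∈ frontier (𝓣.cell k).carrier ∩ frontier (𝓣.cell l).carrier →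
    0 < surface d (frontier (𝓣.cell k).carrier ∩ frontier (𝓣.cell l).carrier)
  surface_facet_pos : ∀ k, ∀ a ∈ (𝓣.cell k).halfSpaces,
    x ∈ (𝓣.cell k).facet a ∩ frontier (Ω : Set (Euc d)) →
    0 < surface d ((𝓣.cell k).facet a ∩ frontier (Ω : Set (Euc d)))

theorem ae_isGeneric : ∀ᵐ x ∂surface d, 𝓣.IsGeneric x := by
  have hpos : ∀ s : Set (Euc d), ∀ᵐ x ∂surface d, x ∈ s → 0 < surface d s := by
    intro s
    rcases eq_or_ne (surface d s) 0 with h | h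
    · exact (measure_eq_zero_iff_ae_notMem.1 h).mono fun x hx hxs => absurd hxs hx
    · exact .of_forall fun x _ => pos_iff_ne_zero.2 h
  have h1 : ∀ᵐ x ∂surface d, ∀ k l, ∀ a ∈ (𝓣.cell k).halfSpaces, ∀ b ∈ (𝓣.cell l).halfSpaces,
      x ∈ hyperplane a → x ∈ hyperplane b → b = a ∨ b = -a := by
    simp only [eventually_all, eventually_all_finset]
    intro k l a ha b hb
    by_cases hab : b = a ∨ b = -a
    · exact .of_forall fun _ _ _ => hab
    push Not at hab
    have h0 := surface_hyperplane_inter_hyperplane ((𝓣.cell k).norm_eq_one a ha)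
      ((𝓣.cell l).norm_eq_one b hb) hab.1 hab.2
    exact (measure_eq_zero_iff_ae_notMem.1 h0).mono fun x hx h1 h2 => absurd ⟨h1, h2⟩ hx
  have h2 : ∀ᵐ x ∂surface d, ∀ k l,
      x ∈ frontier (𝓣.cell k).carrier ∩ frontier (𝓣.cell l).carrier →
      0 < surface d (frontier (𝓣.cell k).carrier ∩ frontier (𝓣.cell l).carrier) := by
    simp only [eventually_all]
    exact fun k l => hpos _
  have h3 : ∀ᵐ x ∂surface d, ∀ k, ∀ a ∈ (𝓣.cell k).halfSpaces,
      x ∈ (𝓣.cell k).facet a ∩ frontier (Ω : Set (Euc d)) →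
      0 < surface d ((𝓣.cell k).facet a ∩ frontier (Ω : Set (Euc d))) := by
    simp only [eventually_all, eventually_all_finset]
    exact fun k a _ => hpos _
  filter_upwards [h1, h2, h3] with x h1 h2 h3 using ⟨h1, h2, h3⟩

variable {𝓣}

theorem disjoint_carrier_interior {k l : Fin 𝓣.numCells} (hkl : k ≠ l) :
    Disjoint (𝓣.cell k).carrier (interior (𝓣.cell l).carrier) :=
  ((𝓣.disjoint_interior hkl).closure_left isOpen_interior).mono_left
    (𝓣.cell k).carrier_subset_closure_interior

/-- Near a point of a cell, the cell is not covered by other cells. -/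
theorem not_eventually_mem_other {k : Fin 𝓣.numCells} {x : Euc d} (hx : x ∈ (𝓣.cell k).carrier) :
    ¬ ∀ᶠ y in 𝓝 x, y ∈ (𝓣.cell k).carrier → ∃ l ≠ k, y ∈ (𝓣.cell l).carrier := by
  intro h
  obtain ⟨y, hyk, hy⟩ := ((mem_closure_iff_frequently.1
    ((𝓣.cell k).carrier_subset_closure_interior hx)).and_eventually h).exists
  obtain ⟨l, hlk, hyl⟩ := hy (interior_subset hyk)
  exact disjoint_left.1 (disjoint_carrier_interior hlk) hyl hyk

theorem carrier_subset_closure (k : Fin 𝓣.numCells) :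
    (𝓣.cell k).carrier ⊆ closure (Ω : Set (Euc d)) :=
  𝓣.iUnion_cell ▸ subset_iUnion (fun k => (𝓣.cell k).carrier) k

theorem mem_frontier_iff {k : Fin 𝓣.numCells} {x : Euc d} (hx : x ∈ (𝓣.cell k).carrier) :
    x ∈ frontier (Ω : Set (Euc d)) ↔ x ∉ Ω := by
  rw [Ω.isOpen.frontier_eq]
  exact ⟨fun h => h.2, fun h => ⟨carrier_subset_closure k hx, h⟩⟩

namespace IsGeneric

variable {x : Euc d} {k l m : Fin 𝓣.numCells} {a b : Euc d × ℝ}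

theorem eq_of_mem_hyperplane (hg : 𝓣.IsGeneric x) (ha : a ∈ (𝓣.cell k).halfSpaces)
    (hb : b ∈ (𝓣.cell k).halfSpaces) (hxa : x ∈ hyperplane a) (hxb : x ∈ hyperplane b) : b = a :=
  (hg.eq_or_eq_neg k k a ha b hb hxa hxb).resolve_right fun h =>
    (𝓣.cell k).neg_notMem_halfSpaces ha (h ▸ hb)

theorem eventually_mem_iff (hg : 𝓣.IsGeneric x) (ha : a ∈ (𝓣.cell k).halfSpaces)
    (hx : x ∈ (𝓣.cell k).facet a) :
    ∀ᶠ y in 𝓝 x, y ∈ (𝓣.cell k).carrier ↔ inner ℝ a.1 y ≤ a.2 :=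
  (𝓣.cell k).eventually_mem_carrier_iff hx.1 ha fun _ hb hxb =>
    hg.eq_of_mem_hyperplane ha hb hx.2 hxb

/-- A second cell through a generic point of a facet lies on the opposite side of that facet. -/
theorem neg_mem_halfSpaces (hg : 𝓣.IsGeneric x) (ha : a ∈ (𝓣.cell k).halfSpaces)
    (hx : x ∈ (𝓣.cell k).facet a) (hlk : l ≠ k) (hxl : x ∈ (𝓣.cell l).carrier) :
    -a ∈ (𝓣.cell l).halfSpaces ∧ x ∈ (𝓣.cell l).facet (-a) := by
  have hfr : x ∈ frontier (𝓣.cell l).carrier := by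
    rw [(𝓣.cell l).isClosed_carrier.frontier_eq]
    exact ⟨hxl, disjoint_left.1 (disjoint_carrier_interior hlk.symm) hx.1⟩
  rw [(𝓣.cell l).frontier_carrier] at hfr
  obtain ⟨b, hb, hxb⟩ := mem_iUnion₂.1 hfr
  rcases hg.eq_or_eq_neg k l a ha b hb hx.2 hxb.2 with rfl | rfl
  · refine absurd ?_ (not_eventually_mem_other hxl)
    filter_upwards [hg.eventually_mem_iff ha hx, hg.eventually_mem_iff hb hxb] with y h1 h2 h3
    exact ⟨k, hlk.symm, h1.2 (h2.1 h3)⟩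
  · exact ⟨hb, hxb⟩

theorem eventually_mem_or (hg : 𝓣.IsGeneric x) (ha : a ∈ (𝓣.cell k).halfSpaces)
    (hx : x ∈ (𝓣.cell k).facet a) (hlk : l ≠ k) (hxl : x ∈ (𝓣.cell l).carrier) :
    ∀ᶠ y in 𝓝 x, y ∈ (𝓣.cell k).carrier ∨ y ∈ (𝓣.cell l).carrier := by
  obtain ⟨hb, hxb⟩ := hg.neg_mem_halfSpaces ha hx hlk hxl
  filter_upwards [hg.eventually_mem_iff ha hx, hg.eventually_mem_iff hb hxb] with y h1 h2
  rw [h1, h2, Prod.fst_neg, Prod.snd_neg, inner_neg_left, neg_le_neg_iff]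
  exact le_total _ _

/-- A generic point that lies in two cells is a point of `Ω`. -/
theorem mem_of_two (hg : 𝓣.IsGeneric x) (ha : a ∈ (𝓣.cell k).halfSpaces)
    (hx : x ∈ (𝓣.cell k).facet a) (hlk : l ≠ k) (hxl : x ∈ (𝓣.cell l).carrier) : x ∈ Ω := by
  have h : x ∈ interior (closure (Ω : Set (Euc d))) := by
    rw [mem_interior_iff_mem_nhds]
    filter_upwards [hg.eventually_mem_or ha hx hlk hxl] with y hy
    exact hy.elim (fun h => carrier_subset_closure k h) fun h => carrier_subset_closure l h
  rwa [𝓣.interior_closure] at h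

theorem eq_or_eq_of_mem (hg : 𝓣.IsGeneric x) (ha : a ∈ (𝓣.cell k).halfSpaces)
    (hx : x ∈ (𝓣.cell k).facet a) (hlk : l ≠ k) (hxl : x ∈ (𝓣.cell l).carrier)
    (hxm : x ∈ (𝓣.cell m).carrier) : m = k ∨ m = l := by
  by_contra! hm
  refine not_eventually_mem_other hxm ?_
  filter_upwards [hg.eventually_mem_or ha hx hlk hxl] with y hy _
  exact hy.elim (fun h => ⟨k, hm.1.symm, h⟩) fun h => ⟨l, hm.2.symm, h⟩

end IsGeneric

theorem notMem_facet_of_mem_interior {k : Fin 𝓣.numCells} {a : Euc d × ℝ} {x : Euc d}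
    (ha : a ∈ (𝓣.cell k).halfSpaces) (hx : x ∈ (𝓣.cell k).facet a) :
    x ∉ interior (𝓣.cell k).carrier := by
  rw [Polytope.interior_carrier]
  exact fun h => (h a ha).ne hx.2

/-- A point of a facet that belongs to `Ω` lies in a second cell. -/
theorem exists_other_cell {k : Fin 𝓣.numCells} {a : Euc d × ℝ} {x : Euc d}
    (ha : a ∈ (𝓣.cell k).halfSpaces) (hx : x ∈ (𝓣.cell k).facet a) (hxΩ : x ∈ Ω) :
    ∃ l ≠ k, x ∈ (𝓣.cell l).carrier := by
  by_contra! h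
  refine notMem_facet_of_mem_interior ha hx (mem_interior_iff_mem_nhds.2 ?_)
  have h1 : ∀ᶠ y in 𝓝 x, ∀ l ≠ k, y ∉ (𝓣.cell l).carrier := by
    simp only [eventually_all]
    exact fun l hl => (𝓣.cell l).isClosed_carrier.isOpen_compl.eventually_mem (h l hl)
  filter_upwards [h1, Ω.isOpen.eventually_mem hxΩ] with y hy hyΩ
  have : y ∈ ⋃ k, (𝓣.cell k).carrier := 𝓣.iUnion_cell ▸ subset_closure hyΩ
  obtain ⟨l, hl⟩ := mem_iUnion.1 this
  by_cases hlk : l = k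
  · rwa [← hlk]
  · exact absurd hl (hy l hlk)

namespace InteriorFace

variable (e : 𝓣.InteriorFace)

theorem fst_lt_snd : e.fst < e.snd := e.2.1

theorem mem_fst {x : Euc d} (hx : x ∈ e.carrier) : x ∈ (𝓣.cell e.fst).carrier :=
  (𝓣.cell e.fst).isClosed_carrier.frontier_subset hx.1

theorem mem_snd {x : Euc d} (hx : x ∈ e.carrier) : x ∈ (𝓣.cell e.snd).carrier :=
  (𝓣.cell e.snd).isClosed_carrier.frontier_subset hx.2

theorem isCompact_carrier : IsCompact e.carrier :=
  (𝓣.cell e.fst).isCompact_carrier.of_isClosed_subset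
    (isClosed_frontier.inter isClosed_frontier) fun _ hx => e.mem_fst hx

theorem surface_carrier_lt_top : surface d e.carrier < ⊤ :=
  (measure_mono inter_subset_left).trans_lt (𝓣.cell e.fst).surface_frontier_lt_top

/-- The normal of an interior face is the normal of the facet of `K` on which it lies. -/
theorem normal_eq {a : Euc d × ℝ} {x : Euc d} (hx : x ∈ e.carrier)
    (hg : 𝓣.IsGeneric x) (ha : a ∈ (𝓣.cell e.fst).halfSpaces)
    (hxa : x ∈ (𝓣.cell e.fst).facet a) : e.normal = a.1 := by
  obtain ⟨hn, hn'⟩ := e.exists_isNormal.choose_spec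
  change ‖e.normal‖ = 1 at hn
  have h1 : ∀ y ∈ (𝓣.cell e.fst).carrier, inner ℝ e.normal (y - x) ≤ 0 := (hn' x hx).1
  have ha1 := (𝓣.cell e.fst).norm_eq_one a ha
  have hxa2 : inner ℝ a.1 x = a.2 := hxa.2
  -- since `K` is a half-space near `x`, the normal cone of `K` at `x` is a ray
  have hray : ∀ z : Euc d, inner ℝ a.1 z ≤ 0 → inner ℝ e.normal z ≤ 0 := by
    intro z hz
    have hc : Tendsto (fun t : ℝ => x + t • z) (𝓝[>] 0) (𝓝 x) := by
      have : Continuous fun t : ℝ => x + t • z := by fun_prop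
      simpa using (this.tendsto 0).mono_left nhdsWithin_le_nhds
    obtain ⟨t, ht, ht0⟩ := ((hc.eventually (hg.eventually_mem_iff ha hxa)).and
      self_mem_nhdsWithin).exists
    have ht0 : 0 < t := ht0
    have h2 := h1 (x + t • z) (ht.2 (by
      rw [inner_add_right, inner_smul_right, hxa2]
      nlinarith))
    rw [add_sub_cancel_left, inner_smul_right] at h2
    exact nonpos_of_mul_nonpos_right h2 ht0
  have hnn : inner ℝ e.normal e.normal = (1 : ℝ) := by rw [real_inner_self_eq_norm_sq, hn]; simp
  have haa : inner ℝ a.1 a.1 = (1 : ℝ) := by rw [real_inner_self_eq_norm_sq, ha1]; simp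
  have hcomm : inner ℝ e.normal a.1 = inner ℝ a.1 e.normal := real_inner_comm _ _
  have h3 := hray (e.normal - (inner ℝ a.1 e.normal : ℝ) • a.1) (by
    rw [inner_sub_right, inner_smul_right, haa]; simp)
  have h4 := hray (-a.1) (by rw [inner_neg_right, haa]; simp)
  rw [inner_sub_right, inner_smul_right, hnn, hcomm] at h3
  rw [inner_neg_right, hcomm] at h4
  have h5 : (1 : ℝ) ≤ inner ℝ a.1 e.normal := by nlinarith
  have h6 : inner ℝ a.1 e.normal ≤ (1 : ℝ) := by
    simpa [ha1, hn] using real_inner_le_norm a.1 e.normal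
  exact (inner_eq_one_iff_of_norm_eq_one hn ha1).1 (hcomm.trans (le_antisymm h6 h5))

end InteriorFace

namespace BoundaryFace

variable (e : 𝓣.BoundaryFace)

theorem isCompact_carrier : IsCompact e.carrier :=
  (𝓣.cell e.idx).isCompact_carrier.of_isClosed_subset
    (((𝓣.cell e.idx).isClosed_facet _).inter isClosed_frontier) fun _ hx => hx.1.1

theorem surface_carrier_lt_top : surface d e.carrier < ⊤ :=
  (measure_mono inter_subset_left).trans_lt ((𝓣.cell e.idx).surface_facet_lt_top e.1.2.2)

end BoundaryFace

end Mesh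

/-! ### From the boundaries of the cells to the faces of the mesh -/

namespace Mesh

variable {d : ℕ} {Ω : Opens (Euc d)} {𝓣 : Mesh Ω}

/-- The integrand, at the point `x`, of the boundary integral over one cell in the Gauss–Green
formula. -/
noncomputable def cellFlux (i : Fin d) (w : 𝓣.Broken) (k : Fin 𝓣.numCells) (x : Euc d) : ℝ :=
  ∑ a ∈ (𝓣.cell k).halfSpaces, a.1 i * ((𝓣.cell k).facet a).indicator (w k) x

theorem cellFlux_of_notMem (i : Fin d) (w : 𝓣.Broken) {k : Fin 𝓣.numCells} {x : Euc d}
    (hx : x ∉ (𝓣.cell k).carrier) : cellFlux i w k x = 0 :=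
  Finset.sum_eq_zero fun a _ => by
    rw [indicator_of_notMem fun h => hx h.1, mul_zero]

theorem IsGeneric.cellFlux_eq {x : Euc d} (hg : 𝓣.IsGeneric x) (i : Fin d) (w : 𝓣.Broken)
    {k : Fin 𝓣.numCells} {a : Euc d × ℝ} (ha : a ∈ (𝓣.cell k).halfSpaces)
    (hx : x ∈ (𝓣.cell k).facet a) : cellFlux i w k x = a.1 i * w k x := by
  unfold cellFlux
  rw [Finset.sum_eq_single_of_mem a ha, indicator_of_mem hx]
  intro b hb hba
  rw [indicator_of_notMem fun h => hba (hg.eq_of_mem_hyperplane ha hb hx.2 h.2), mul_zero]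

/-- The integrand, at the point `x`, of the sum over all faces of the jumps times the normals. -/
noncomputable def faceFlux (i : Fin d) (w : 𝓣.Broken) (x : Euc d) : ℝ :=
  ∑ e : 𝓣.InteriorFace, e.normal i * e.carrier.indicator (jump w e) x +
    ∑ e : 𝓣.BoundaryFace, e.normal i * e.carrier.indicator (w e.idx) x

/-- At a generic point between the cells `k < l`, the two cells contribute the jump. -/
theorem IsGeneric.sum_cellFlux_of_two {x : Euc d} (hg : 𝓣.IsGeneric x) (i : Fin d)
    (w : 𝓣.Broken) {k l : Fin 𝓣.numCells} {a : Euc d × ℝ} (hkl : k < l)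
    (ha : a ∈ (𝓣.cell k).halfSpaces) (hx : x ∈ (𝓣.cell k).facet a)
    (hxl : x ∈ (𝓣.cell l).carrier) : ∑ k, cellFlux i w k x = faceFlux i w x := by
  obtain ⟨hb, hxb⟩ := hg.neg_mem_halfSpaces ha hx hkl.ne' hxl
  have hxΩ := hg.mem_of_two ha hx hkl.ne' hxl
  have honly : ∀ m, x ∈ (𝓣.cell m).carrier → m = k ∨ m = l := fun m =>
    hg.eq_or_eq_of_mem ha hx hkl.ne' hxl
  have hfk : x ∈ frontier (𝓣.cell k).carrier := by
    rw [Polytope.frontier_carrier]; exact mem_iUnion₂.2 ⟨a, ha, hx⟩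
  have hfl : x ∈ frontier (𝓣.cell l).carrier := by
    rw [Polytope.frontier_carrier]; exact mem_iUnion₂.2 ⟨-a, hb, hxb⟩
  let e₀ : 𝓣.InteriorFace := ⟨(k, l), hkl, hg.surface_frontier_pos k l ⟨hfk, hfl⟩⟩
  have hx₀ : x ∈ e₀.carrier := ⟨hfk, hfl⟩
  have hB : ∑ e : 𝓣.BoundaryFace, e.normal i * e.carrier.indicator (w e.idx) x = 0 :=
    Finset.sum_eq_zero fun e _ => by
      rw [indicator_of_notMem fun h => ?_, mul_zero]
      exact (mem_frontier_iff hx.1).1 h.2 hxΩ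
  have hI : ∑ e : 𝓣.InteriorFace, e.normal i * e.carrier.indicator (jump w e) x =
      e₀.normal i * jump w e₀ x := by
    rw [Fintype.sum_eq_single e₀, indicator_of_mem hx₀]
    intro e he
    rw [indicator_of_notMem fun h => he ?_, mul_zero]
    have hlt := e.fst_lt_snd
    rcases honly _ (e.mem_fst h) with h1 | h1 <;> rcases honly _ (e.mem_snd h) with h2 | h2
    · exact absurd hlt (by rw [h1, h2]; exact lt_irrefl _)
    · exact Subtype.ext (Prod.ext h1 h2)
    · exact absurd hlt (by rw [h1, h2]; exact hkl.le.not_gt)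
    · exact absurd hlt (by rw [h1, h2]; exact lt_irrefl _)
  have hn : e₀.normal = a.1 := e₀.normal_eq hx₀ hg ha hx
  unfold faceFlux
  rw [hB, hI, hn, Fintype.sum_eq_add k l hkl.ne, hg.cellFlux_eq i w ha hx,
    hg.cellFlux_eq i w hb hxb]
  · simp only [jump, e₀, InteriorFace.fst, InteriorFace.snd, Prod.fst_neg, PiLp.neg_apply]
    ring
  · intro m hm
    exact cellFlux_of_notMem i w fun h => (honly m h).elim hm.1 hm.2

theorem IsGeneric.sum_cellFlux {x : Euc d} (hg : 𝓣.IsGeneric x) (i : Fin d) (w : 𝓣.Broken) :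
    ∑ k, cellFlux i w k x = faceFlux i w x := by
  by_cases hfacet : ∃ k, ∃ a ∈ (𝓣.cell k).halfSpaces, x ∈ (𝓣.cell k).facet a
  · obtain ⟨k, a, ha, hx⟩ := hfacet
    by_cases htwo : ∃ l ≠ k, x ∈ (𝓣.cell l).carrier
    · obtain ⟨l, hlk, hxl⟩ := htwo
      rcases lt_or_gt_of_ne hlk with h | h
      · obtain ⟨hb, hxb⟩ := hg.neg_mem_halfSpaces ha hx hlk hxl
        exact hg.sum_cellFlux_of_two i w h hb hxb hx.1
      · exact hg.sum_cellFlux_of_two i w h ha hx hxl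
    · -- a single cell: a generic point of the boundary of `Ω`
      have honly : ∀ m, x ∈ (𝓣.cell m).carrier → m = k := fun m hm => by
        by_contra h; exact htwo ⟨m, h, hm⟩
      have hxfr : x ∈ frontier (Ω : Set (Euc d)) :=
        (mem_frontier_iff hx.1).2 fun h => htwo (exists_other_cell ha hx h)
      let e₀ : 𝓣.BoundaryFace := ⟨⟨k, a, ha⟩, hg.surface_facet_pos k a ha ⟨hx, hxfr⟩⟩
      have hx₀ : x ∈ e₀.carrier := ⟨hx, hxfr⟩
      have hI : ∑ e : 𝓣.InteriorFace, e.normal i * e.carrier.indicator (jump w e) x = 0 :=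
        Finset.sum_eq_zero fun e _ => by
          rw [indicator_of_notMem fun h => ?_, mul_zero]
          exact e.fst_lt_snd.ne ((honly _ (e.mem_fst h)).trans (honly _ (e.mem_snd h)).symm)
      have hB : ∑ e : 𝓣.BoundaryFace, e.normal i * e.carrier.indicator (w e.idx) x =
          a.1 i * w k x := by
        rw [Fintype.sum_eq_single e₀, indicator_of_mem hx₀]
        · rfl
        rintro ⟨⟨m, b, hb⟩, hpos⟩ he
        rw [indicator_of_notMem fun h => he ?_, mul_zero]
        have hm : m = k := honly m h.1.1
        subst hm
        have hba : b = a := hg.eq_of_mem_hyperplane ha hb hx.2 h.1.2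
        subst hba
        rfl
      unfold faceFlux
      rw [hI, hB, Fintype.sum_eq_single k fun m hm => cellFlux_of_notMem i w fun h =>
        hm (honly m h), hg.cellFlux_eq i w ha hx, zero_add]
  · push Not at hfacet
    have hI : ∑ e : 𝓣.InteriorFace, e.normal i * e.carrier.indicator (jump w e) x = 0 :=
      Finset.sum_eq_zero fun e _ => by
        rw [indicator_of_notMem fun h => ?_, mul_zero]
        have h1 := h.1
        rw [Polytope.frontier_carrier] at h1
        obtain ⟨a, ha, hxa⟩ := mem_iUnion₂.1 h1
        exact hfacet _ a ha hxa
    have hB : ∑ e : 𝓣.BoundaryFace, e.normal i * e.carrier.indicator (w e.idx) x = 0 :=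
      Finset.sum_eq_zero fun e _ => by
        rw [indicator_of_notMem fun h => hfacet _ _ e.1.2.2 h.1, mul_zero]
    unfold faceFlux
    rw [hI, hB, add_zero]
    exact Finset.sum_eq_zero fun k _ => Finset.sum_eq_zero fun a ha => by
      rw [indicator_of_notMem (hfacet k a ha), mul_zero]

/-- Integrals of a piecewise continuous function over the boundaries of all cells, rearranged into
integrals over the faces of the mesh. -/
theorem sum_integral_facet (i : Fin d) {w : 𝓣.Broken}
    (hw : ∀ k, ContinuousOn (w k) (𝓣.cell k).carrier) :
    ∑ k, ∑ a ∈ (𝓣.cell k).halfSpaces,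
        a.1 i * ∫ x in (𝓣.cell k).facet a, w k x ∂surface d =
      ∑ e : 𝓣.InteriorFace, e.normal i * ∫ x in e.carrier, jump w e x ∂surface d +
        ∑ e : 𝓣.BoundaryFace, e.normal i * ∫ x in e.carrier, w e.idx x ∂surface d := by
  have hK : ∀ k, ∀ a ∈ (𝓣.cell k).halfSpaces,
      Integrable (((𝓣.cell k).facet a).indicator (w k)) (surface d) := fun k a ha => by
    rw [integrable_indicator_iff ((𝓣.cell k).isClosed_facet a).measurableSet]
    exact integrableOn_surface ((𝓣.cell k).isCompact_carrier.of_isClosed_subset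
      ((𝓣.cell k).isClosed_facet a) fun _ hx => hx.1) ((𝓣.cell k).surface_facet_lt_top ha)
      ((hw k).mono fun _ hx => hx.1)
  have hI : ∀ e : 𝓣.InteriorFace, Integrable (e.carrier.indicator (jump w e)) (surface d) :=
    fun e => by
    rw [integrable_indicator_iff e.isCompact_carrier.measurableSet]
    exact integrableOn_surface e.isCompact_carrier e.surface_carrier_lt_top
      (((hw e.fst).mono fun _ hx => e.mem_fst hx).sub ((hw e.snd).mono fun _ hx => e.mem_snd hx))
  have hB : ∀ e : 𝓣.BoundaryFace, Integrable (e.carrier.indicator (w e.idx)) (surface d) :=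
    fun e => by
    rw [integrable_indicator_iff e.isCompact_carrier.measurableSet]
    exact integrableOn_surface e.isCompact_carrier e.surface_carrier_lt_top
      ((hw e.idx).mono fun _ hx => hx.1.1)
  have hcell : ∀ k, Integrable (cellFlux i w k) (surface d) := fun k =>
    integrable_finsetSum _ fun a ha => (hK k a ha).const_mul _
  have h1 : ∫ x, ∑ k, cellFlux i w k x ∂surface d = ∑ k, ∑ a ∈ (𝓣.cell k).halfSpaces,
        a.1 i * ∫ x in (𝓣.cell k).facet a, w k x ∂surface d := by
    rw [integral_finsetSum _ fun k _ => hcell k]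
    refine Finset.sum_congr rfl fun k _ => ?_
    unfold cellFlux
    rw [integral_finsetSum _ fun a ha => (hK k a ha).const_mul _]
    refine Finset.sum_congr rfl fun a _ => ?_
    rw [integral_const_mul, integral_indicator ((𝓣.cell k).isClosed_facet a).measurableSet]
  have h2 : ∫ x, faceFlux i w x ∂surface d =
      ∑ e : 𝓣.InteriorFace, e.normal i * ∫ x in e.carrier, jump w e x ∂surface d +
        ∑ e : 𝓣.BoundaryFace, e.normal i * ∫ x in e.carrier, w e.idx x ∂surface d := by
    unfold faceFlux
    rw [integral_add (integrable_finsetSum _ fun e _ => (hI e).const_mul _)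
      (integrable_finsetSum _ fun e _ => (hB e).const_mul _),
      integral_finsetSum _ fun e _ => (hI e).const_mul _,
      integral_finsetSum _ fun e _ => (hB e).const_mul _]
    congr 1
    · refine Finset.sum_congr rfl fun e _ => ?_
      rw [integral_const_mul, integral_indicator e.isCompact_carrier.measurableSet]
    · refine Finset.sum_congr rfl fun e _ => ?_
      rw [integral_const_mul, integral_indicator e.isCompact_carrier.measurableSet]
  rw [← h1, ← h2]
  exact integral_congr_ae (𝓣.ae_isGeneric.mono fun x hx => hx.sum_cellFlux i w)

/-- Piecewise integration by parts on the mesh. -/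
theorem brokenInner_lineDeriv (i : Fin d) (v : 𝓣.PiecewiseSpace) {φ : 𝓣.Broken}
    (hφ : ∀ k, ContDiff ℝ (⊤ : ℕ∞) (φ k)) :
    brokenInner v.toFun (fun k x => lineDeriv ℝ (φ k) x (coordDir i)) =
      ∑ e : 𝓣.InteriorFace, e.normal i *
          ∫ x in e.carrier, jump (fun k x => v.toFun k x * φ k x) e x ∂surface d +
        ∑ e : 𝓣.BoundaryFace, e.normal i *
          ∫ x in e.carrier, v.toFun e.idx x * φ e.idx x ∂surface d -
        brokenInner (v.weakPartial i) φ := by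
  rw [← sum_integral_facet i (w := fun k x => v.toFun k x * φ k x)
    fun k => (v.continuousOn k).mul (hφ k).continuous.continuousOn]
  unfold brokenInner
  rw [← Finset.sum_sub_distrib]
  exact Finset.sum_congr rfl fun k _ => (𝓣.cell k).integral_mul_lineDeriv (v.continuousOn k)
    ((v.memW11 k).2 i).choose_spec (hφ k)

end Mesh

/-! ### The distributional derivative of a piecewise function -/

namespace Mesh

variable {d : ℕ} {Ω : Opens (Euc d)} {𝓣 : Mesh Ω}

theorem integrable_glue {w : 𝓣.Broken} (hw : ∀ k, IntegrableOn (w k) (𝓣.cell k).carrier) :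
    Integrable (glue w) := by
  unfold glue
  refine integrable_finsetSum _ fun k _ => ?_
  rw [integrable_indicator_iff isOpen_interior.measurableSet]
  exact (hw k).mono_set interior_subset

theorem integral_mul_glue {w : 𝓣.Broken} (hw : ∀ k, IntegrableOn (w k) (𝓣.cell k).carrier)
    {ψ : Euc d → ℝ} (hψ : Continuous ψ) :
    ∫ x, ψ x * glue w x = brokenInner w fun _ => ψ := by
  have h : ∀ x, ψ x * glue w x =
      ∑ k, (interior (𝓣.cell k).carrier).indicator (fun x => w k x * ψ x) x := fun x => by
    rw [glue, Finset.mul_sum]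
    refine Finset.sum_congr rfl fun k _ => ?_
    by_cases hx : x ∈ interior (𝓣.cell k).carrier
    · simp only [indicator_of_mem hx, mul_comm]
    · simp only [indicator_of_notMem hx, mul_zero]
  simp only [h]
  rw [integral_finsetSum]
  · refine Finset.sum_congr rfl fun k _ => ?_
    rw [integral_indicator isOpen_interior.measurableSet, Polytope.setIntegral_interior]
  · intro k _
    rw [integrable_indicator_iff isOpen_interior.measurableSet]
    exact ((hw k).mul_continuousOn hψ.continuousOn (𝓣.cell k).isCompact_carrier).mono_set
      interior_subset

theorem PiecewiseSpace.integrableOn (v : 𝓣.PiecewiseSpace) (k : Fin 𝓣.numCells) :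
    IntegrableOn (v.toFun k) (𝓣.cell k).carrier :=
  (v.continuousOn k).integrableOn_compact (𝓣.cell k).isCompact_carrier

theorem PiecewiseSpace.integrableOn_weakPartial (v : 𝓣.PiecewiseSpace) (i : Fin d)
    (k : Fin 𝓣.numCells) : IntegrableOn (v.weakPartial i k) (𝓣.cell k).carrier :=
  (𝓣.cell k).integrableOn_carrier_iff.2 ((v.memW11 k).2 i).choose_spec.1

theorem PiecewiseSpace.continuousOn_jump (v : 𝓣.PiecewiseSpace) (e : 𝓣.InteriorFace) :
    ContinuousOn (jump v.toFun e) e.carrier :=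
  ((v.continuousOn e.fst).mono fun _ hx => e.mem_fst hx).sub
    ((v.continuousOn e.snd).mono fun _ hx => e.mem_snd hx)

theorem deltaDist_apply (v : 𝓣.PiecewiseSpace) (e : 𝓣.InteriorFace) (φ : 𝓓(Ω, ℝ)) :
    deltaDist Ω e.carrier (jump v.toFun e) φ =
      ∫ x in e.carrier, φ x * jump v.toFun e x ∂surface d := by
  have h : Integrable (jump v.toFun e) ((surface d).restrict e.carrier) :=
    integrableOn_surface e.isCompact_carrier e.surface_carrier_lt_top (v.continuousOn_jump e)
  exact TestFunction.integralAgainstBilinCLM_eq_integral (h.integrableOn.locallyIntegrableOn)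

theorem distDeriv_apply (v : 𝓣.PiecewiseSpace) (i : Fin d) (φ : 𝓓(Ω, ℝ)) :
    v.distDeriv i φ = -∫ x, lineDeriv ℝ φ x (coordDir i) * glue v.toFun x := by
  have h : LocallyIntegrableOn (glue v.toFun) Ω :=
    (integrable_glue v.integrableOn).integrableOn.locallyIntegrableOn
  rw [PiecewiseSpace.distDeriv, Distribution.lineDerivOp_apply_apply, map_neg,
    regularDist_apply h]
  congr 2 with x
  rw [TestFunction.lineDerivOp_eq_lineDerivCLM ℝ, TestFunction.lineDerivCLM_apply_of_le (by simp)]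

/-- Piecewise integration by parts against a test function, which has no jumps and vanishes on the
boundary faces. -/
theorem distDeriv_eq (v : 𝓣.PiecewiseSpace) (i : Fin d) :
    v.distDeriv i = regularDist Ω (glue (v.weakPartial i)) -
      ∑ e : 𝓣.InteriorFace, e.normal i • deltaDist Ω e.carrier (jump v.toFun e) := by
  ext φ
  have hφ : ContDiff ℝ (⊤ : ℕ∞) φ := φ.contDiff
  have hg : LocallyIntegrableOn (glue (v.weakPartial i)) Ω :=
    (integrable_glue (v.integrableOn_weakPartial i)).integrableOn.locallyIntegrableOn
  have hφ1 : Continuous fun x => lineDeriv ℝ φ x (coordDir i) := continuous_lineDeriv hφ _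
  have hB : ∑ e : 𝓣.BoundaryFace, e.normal i *
      ∫ x in e.carrier, v.toFun e.idx x * φ x ∂surface d = 0 :=
    Finset.sum_eq_zero fun e _ => by
      rw [setIntegral_eq_zero_of_forall_eq_zero, mul_zero]
      intro x hx
      have hxΩ : x ∉ Ω := (mem_frontier_iff hx.1.1).1 hx.2
      rw [image_eq_zero_of_notMem_tsupport fun h => hxΩ (φ.tsupport_subset h), mul_zero]
  have hmain := brokenInner_lineDeriv i v (φ := fun _ => φ) fun _ => hφ
  rw [hB, add_zero] at hmain
  have hR : (regularDist Ω (glue (v.weakPartial i)) -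
      ∑ e : 𝓣.InteriorFace, e.normal i • deltaDist Ω e.carrier (jump v.toFun e)) φ =
      regularDist Ω (glue (v.weakPartial i)) φ -
        ∑ e : 𝓣.InteriorFace, e.normal i * deltaDist Ω e.carrier (jump v.toFun e) φ := by
    simp [sub_apply, sum_apply]
  rw [hR, distDeriv_apply, integral_mul_glue v.integrableOn hφ1, hmain, regularDist_apply hg,
    integral_mul_glue (v.integrableOn_weakPartial i) hφ.continuous, neg_sub]
  congr 1
  refine Finset.sum_congr rfl fun e _ => ?_
  rw [deltaDist_apply]
  congr 2 with x
  simp only [jump]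
  ring

end Mesh

/-! ### Piecewise polynomials and discrete derivatives -/

section Polynomials

variable {d : ℕ}

theorem contDiff_mvPolynomial_eval (p : MvPolynomial (Fin d) ℝ) {n : ℕ∞} :
    ContDiff ℝ n fun x : Euc d => MvPolynomial.eval (fun j => x j) p := by
  induction p using MvPolynomial.induction_on with
  | C c => simpa using contDiff_const
  | add p q hp hq => simpa using hp.add hq
  | mul_X p j hp =>
    simp only [map_mul, MvPolynomial.eval_X]
    exact hp.mul (by fun_prop)

theorem hasLineDerivAt_mvPolynomial_eval (p : MvPolynomial (Fin d) ℝ) (i : Fin d) (x : Euc d) :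
    HasLineDerivAt ℝ (fun x : Euc d => MvPolynomial.eval (fun j => x j) p)
      (MvPolynomial.eval (fun j => x j) (MvPolynomial.pderiv i p)) x (coordDir i) := by
  induction p using MvPolynomial.induction_on with
  | C c => simpa [HasLineDerivAt] using hasDerivAt_const (0 : ℝ) c
  | add p q hp hq =>
    simp only [map_add]
    exact HasDerivAt.add hp hq
  | mul_X p j hp =>
    have hj : HasDerivAt (fun t : ℝ => (x + t • coordDir i) j) (coordDir i j) 0 := by
      simpa using ((hasDerivAt_id (0 : ℝ)).mul_const (coordDir i j)).const_add (x j)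
    have h := HasDerivAt.mul hp hj
    unfold HasLineDerivAt
    convert! h using 1
    · ext t; simp
    · by_cases hij : i = j
      · subst hij; simp [coordDir]; ring
      · simp [coordDir, MvPolynomial.pderiv_X, Ne.symm hij]; ring

/-- A polynomial that vanishes on a set with nonempty interior is zero. -/
theorem mvPolynomial_eq_zero {p : MvPolynomial (Fin d) ℝ} {U : Set (Euc d)} (hU : IsOpen U)
    (hne : U.Nonempty) (h : ∀ x ∈ U, MvPolynomial.eval (fun j => x j) p = 0) : p = 0 := by
  obtain ⟨x, hx⟩ := hne
  have hc : Continuous fun y : Fin d → ℝ => (WithLp.toLp 2 y : Euc d) := by fun_prop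
  have hV : (fun y : Fin d → ℝ => (WithLp.toLp 2 y : Euc d)) ⁻¹' U ∈ 𝓝 (fun j => x j) :=
    (hU.preimage hc).mem_nhds (by simpa using hx)
  rw [nhds_pi, Filter.mem_pi'] at hV
  obtain ⟨I, t, ht, hsub⟩ := hV
  refine MvPolynomial.funext_set t (fun j => infinite_of_mem_nhds (x j) (ht j)) fun y hy => ?_
  rw [map_zero]
  exact h (WithLp.toLp 2 y) (hsub fun j _ => hy j (mem_univ j))

end Polynomials

namespace Mesh

variable {d : ℕ} {Ω : Opens (Euc d)} {𝓣 : Mesh Ω} {r : ℕ}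

namespace DGSpace

theorem contDiff_toFun (φ : 𝓣.DGSpace r) (k : Fin 𝓣.numCells) {n : ℕ∞} :
    ContDiff ℝ n (DGSpace.toFun φ k) :=
  contDiff_mvPolynomial_eval _

theorem continuous_toFun (φ : 𝓣.DGSpace r) (k : Fin 𝓣.numCells) :
    Continuous (DGSpace.toFun φ k) :=
  (contDiff_toFun φ k (n := 0)).continuous

theorem continuous_partialDeriv (φ : 𝓣.DGSpace r) (i : Fin d) (k : Fin 𝓣.numCells) :
    Continuous (DGSpace.partialDeriv φ i k) :=
  (contDiff_mvPolynomial_eval _ (n := 0)).continuous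

theorem partialDeriv_eq (φ : 𝓣.DGSpace r) (i : Fin d) :
    DGSpace.partialDeriv φ i = fun k x => lineDeriv ℝ (DGSpace.toFun φ k) x (coordDir i) := by
  ext k x
  exact (hasLineDerivAt_mvPolynomial_eval _ i x).lineDeriv.symm

theorem toFun_add (φ ψ : 𝓣.DGSpace r) (k : Fin 𝓣.numCells) (x : Euc d) :
    DGSpace.toFun (φ + ψ) k x = DGSpace.toFun φ k x + DGSpace.toFun ψ k x := by
  simp [DGSpace.toFun]

theorem toFun_smul (c : ℝ) (φ : 𝓣.DGSpace r) (k : Fin 𝓣.numCells) (x : Euc d) :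
    DGSpace.toFun (c • φ) k x = c * DGSpace.toFun φ k x := by
  simp [DGSpace.toFun]

theorem partialDeriv_add (φ ψ : 𝓣.DGSpace r) (i : Fin d) (k : Fin 𝓣.numCells) (x : Euc d) :
    DGSpace.partialDeriv (φ + ψ) i k x =
      DGSpace.partialDeriv φ i k x + DGSpace.partialDeriv ψ i k x := by
  simp [DGSpace.partialDeriv]

theorem partialDeriv_smul (c : ℝ) (φ : 𝓣.DGSpace r) (i : Fin d) (k : Fin 𝓣.numCells)
    (x : Euc d) : DGSpace.partialDeriv (c • φ) i k x = c * DGSpace.partialDeriv φ i k x := by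
  simp [DGSpace.partialDeriv]

end DGSpace

theorem brokenInner_comm (v w : 𝓣.Broken) : brokenInner v w = brokenInner w v := by
  simp only [brokenInner, mul_comm]

theorem brokenInner_add_right {v w₁ w₂ : 𝓣.Broken}
    (hv : ∀ k, IntegrableOn (v k) (𝓣.cell k).carrier) (h₁ : ∀ k, Continuous (w₁ k))
    (h₂ : ∀ k, Continuous (w₂ k)) :
    brokenInner v (fun k x => w₁ k x + w₂ k x) = brokenInner v w₁ + brokenInner v w₂ := by
  simp only [brokenInner]
  rw [← Finset.sum_add_distrib]
  refine Finset.sum_congr rfl fun k _ => ?_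
  rw [← integral_add ((hv k).mul_continuousOn (h₁ k).continuousOn (𝓣.cell k).isCompact_carrier)
    ((hv k).mul_continuousOn (h₂ k).continuousOn (𝓣.cell k).isCompact_carrier)]
  simp only [mul_add]

theorem brokenInner_smul_right (c : ℝ) (v w : 𝓣.Broken) :
    brokenInner v (fun k x => c * w k x) = c * brokenInner v w := by
  simp only [brokenInner]
  rw [Finset.mul_sum]
  refine Finset.sum_congr rfl fun k _ => ?_
  rw [← integral_const_mul]
  congr 1 with x
  ring

theorem integrableOn_of_continuous {f : Euc d → ℝ} (hf : Continuous f) (k : Fin 𝓣.numCells) :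
    IntegrableOn f (𝓣.cell k).carrier :=
  hf.continuousOn.integrableOn_compact (𝓣.cell k).isCompact_carrier

theorem DGSpace.eq_zero_of_brokenInner_self {p : 𝓣.DGSpace r}
    (h : brokenInner (DGSpace.toFun p) (DGSpace.toFun p) = 0) : p = 0 := by
  ext1 k
  have hc : Continuous fun x => DGSpace.toFun p k x * DGSpace.toFun p k x :=
    (DGSpace.continuous_toFun p k).mul (DGSpace.continuous_toFun p k)
  have hk : ∫ x in (𝓣.cell k).carrier, DGSpace.toFun p k x * DGSpace.toFun p k x = 0 :=
    (Finset.sum_eq_zero_iff_of_nonneg fun k _ => integral_nonneg fun x => mul_self_nonneg _).1 h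
      k (Finset.mem_univ k)
  rw [← Polytope.setIntegral_interior, setIntegral_eq_zero_iff_of_nonneg_ae
    (.of_forall fun x => mul_self_nonneg _)
    ((integrableOn_of_continuous hc k).mono_set interior_subset)] at hk
  have hz := Measure.eqOn_open_of_ae_eq hk isOpen_interior hc.continuousOn continuousOn_const
  refine Subtype.ext (mvPolynomial_eq_zero isOpen_interior (𝓣.cell k).nonempty_interior
    fun x hx => ?_)
  exact mul_self_eq_zero.1 (hz hx)

/-- The piecewise `L²` inner product on `V_r^h`. -/
noncomputable def DGSpace.innerForm : 𝓣.DGSpace r →ₗ[ℝ] 𝓣.DGSpace r →ₗ[ℝ] ℝ :=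
  LinearMap.mk₂ ℝ (fun p φ => brokenInner (DGSpace.toFun p) (DGSpace.toFun φ))
    (fun p q φ => by
      rw [brokenInner_comm, brokenInner_comm (DGSpace.toFun p), brokenInner_comm (DGSpace.toFun q),
        ← brokenInner_add_right (fun k => integrableOn_of_continuous (φ.continuous_toFun k) k)
        p.continuous_toFun q.continuous_toFun]
      simp only [← DGSpace.toFun_add])
    (fun c p φ => by
      rw [brokenInner_comm, brokenInner_comm (DGSpace.toFun p), smul_eq_mul,
        ← brokenInner_smul_right]
      simp only [← DGSpace.toFun_smul])
    (fun p φ ψ => by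
      rw [← brokenInner_add_right (fun k => integrableOn_of_continuous (p.continuous_toFun k) k)
        φ.continuous_toFun ψ.continuous_toFun]
      simp only [← DGSpace.toFun_add])
    (fun c p φ => by
      rw [smul_eq_mul, ← brokenInner_smul_right]
      simp only [← DGSpace.toFun_smul])

theorem DGSpace.innerForm_injective :
    Function.Injective (DGSpace.innerForm : 𝓣.DGSpace r →ₗ[ℝ] 𝓣.DGSpace r →ₗ[ℝ] ℝ) := by
  rw [← LinearMap.ker_eq_bot, LinearMap.ker_eq_bot']
  exact fun p hp => DGSpace.eq_zero_of_brokenInner_self (LinearMap.congr_fun hp p)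

theorem DGSpace.innerForm_surjective :
    Function.Surjective (DGSpace.innerForm : 𝓣.DGSpace r →ₗ[ℝ] 𝓣.DGSpace r →ₗ[ℝ] ℝ) :=
  (LinearMap.injective_iff_surjective_of_finrank_eq_finrank
    (Subspace.dual_finrank_eq (K := ℝ) (V := 𝓣.DGSpace r)).symm).1 DGSpace.innerForm_injective

/-- The Riesz representation of a linear functional on `V_r^h`. -/
theorem DGSpace.existsUnique_brokenInner_eq {F : 𝓣.DGSpace r → ℝ} (hF : IsLinearMap ℝ F) :
    ∃! p : 𝓣.DGSpace r, ∀ φ : 𝓣.DGSpace r,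
      brokenInner (DGSpace.toFun p) (DGSpace.toFun φ) = F φ := by
  obtain ⟨p, hp⟩ := DGSpace.innerForm_surjective hF.mk'
  refine ⟨p, fun φ => LinearMap.congr_fun hp φ, fun q hq => DGSpace.innerForm_injective ?_⟩
  rw [hp]
  exact LinearMap.ext hq

/-- Face integrals against a linear expression `L φ` in `φ ∈ V_r^h` are linear in `φ`. -/
theorem isLinearMap_setIntegral_mul {s : Set (Euc d)} (hs : IsCompact s) (hμ : surface d s < ⊤)
    {u : Euc d → ℝ} (hu : ContinuousOn u s) {L : 𝓣.DGSpace r → Euc d → ℝ}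
    (hL : ∀ φ, Continuous (L φ)) (hadd : ∀ φ ψ x, L (φ + ψ) x = L φ x + L ψ x)
    (hsmul : ∀ (c : ℝ) φ x, L (c • φ) x = c * L φ x) :
    IsLinearMap ℝ fun φ => ∫ x in s, u x * L φ x ∂surface d where
  map_add φ ψ := by
    have hi : ∀ φ, IntegrableOn (fun x => u x * L φ x) s (surface d) := fun φ =>
      integrableOn_surface hs hμ (hu.mul (hL φ).continuousOn)
    rw [← integral_add (hi φ) (hi ψ)]
    simp only [hadd, mul_add]
  map_smul c φ := by
    rw [smul_eq_mul, ← integral_const_mul]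
    congr 1 with x
    rw [hsmul]; ring

theorem continuous_jump_toFun (φ : 𝓣.DGSpace r) (e : 𝓣.InteriorFace) :
    Continuous (jump (DGSpace.toFun φ) e) :=
  (φ.continuous_toFun e.fst).sub (φ.continuous_toFun e.snd)

theorem dgFunctional_zero (Q : 𝓣.Broken → 𝓣.InteriorFace → Euc d → ℝ) (i : Fin d)
    (v : 𝓣.Broken) (φ : 𝓣.DGSpace r) :
    dgFunctional Q 0 i v φ = (∑ e : 𝓣.InteriorFace,
      ∫ x in e.carrier, Q v e x * e.normal i * jump (DGSpace.toFun φ) e x ∂(surface d))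
    + (∑ e : 𝓣.BoundaryFace,
      ∫ x in e.carrier, v e.idx x * e.normal i * DGSpace.toFun φ e.idx x ∂(surface d))
    - brokenInner v (DGSpace.partialDeriv φ i) := by
  simp [dgFunctional]

theorem isLinearMap_dgFunctional {Q : 𝓣.Broken → 𝓣.InteriorFace → Euc d → ℝ} (i : Fin d)
    (v : 𝓣.PiecewiseSpace) (hQ : ∀ e, ContinuousOn (Q v.toFun e) e.carrier) :
    IsLinearMap ℝ fun φ : 𝓣.DGSpace r => dgFunctional Q 0 i v.toFun φ := by
  have hI : ∀ e : 𝓣.InteriorFace, IsLinearMap ℝ fun φ : 𝓣.DGSpace r => ∫ x in e.carrier,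
      Q v.toFun e x * e.normal i * jump (DGSpace.toFun φ) e x ∂(surface d) := fun e =>
    isLinearMap_setIntegral_mul e.isCompact_carrier e.surface_carrier_lt_top
      ((hQ e).mul continuousOn_const) (fun φ => continuous_jump_toFun φ e)
      (fun φ ψ x => by simp only [jump, DGSpace.toFun_add]; ring)
      (fun c φ x => by simp only [jump, DGSpace.toFun_smul]; ring)
  have hB : ∀ e : 𝓣.BoundaryFace, IsLinearMap ℝ fun φ : 𝓣.DGSpace r => ∫ x in e.carrier,
      v.toFun e.idx x * e.normal i * DGSpace.toFun φ e.idx x ∂(surface d) := fun e =>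
    isLinearMap_setIntegral_mul e.isCompact_carrier e.surface_carrier_lt_top
      (((v.continuousOn e.idx).mono fun _ hx => hx.1.1).mul continuousOn_const)
      (fun φ => φ.continuous_toFun e.idx) (fun φ ψ x => DGSpace.toFun_add φ ψ _ x)
      (fun c φ x => DGSpace.toFun_smul c φ _ x)
  have hD : IsLinearMap ℝ fun φ : 𝓣.DGSpace r =>
      brokenInner v.toFun (DGSpace.partialDeriv φ i) :=
    { map_add := fun φ ψ => by
        rw [← brokenInner_add_right v.integrableOn (φ.continuous_partialDeriv i)
          (ψ.continuous_partialDeriv i)]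
        simp only [← DGSpace.partialDeriv_add]
      map_smul := fun c φ => by
        rw [smul_eq_mul, ← brokenInner_smul_right]
        simp only [← DGSpace.partialDeriv_smul] }
  simp only [dgFunctional_zero]
  constructor
  · intro φ ψ
    simp only [fun e => (hI e).map_add φ ψ, fun e => (hB e).map_add φ ψ, hD.map_add φ ψ,
      Finset.sum_add_distrib]
    ring
  · intro c φ
    simp only [fun e => (hI e).map_smul c φ, fun e => (hB e).map_smul c φ, hD.map_smul c φ,
      smul_eq_mul, ← Finset.mul_sum]
    ring

theorem continuousOn_traceMinus (i : Fin d) (v : 𝓣.PiecewiseSpace) (e : 𝓣.InteriorFace) :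
    ContinuousOn (traceMinus i v.toFun e) e.carrier := by
  unfold traceMinus
  split_ifs
  · exact (v.continuousOn e.fst).mono fun _ hx => e.mem_fst hx
  · exact (v.continuousOn e.snd).mono fun _ hx => e.mem_snd hx

theorem continuousOn_tracePlus (i : Fin d) (v : 𝓣.PiecewiseSpace) (e : 𝓣.InteriorFace) :
    ContinuousOn (tracePlus i v.toFun e) e.carrier := by
  unfold tracePlus
  split_ifs
  · exact (v.continuousOn e.snd).mono fun _ hx => e.mem_snd hx
  · exact (v.continuousOn e.fst).mono fun _ hx => e.mem_fst hx

/-- The two one-sided face integrals add up to twice the integral with the average of `v`; the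
product rule `[v φ] = {v} [φ] + [v] {φ}` does the rest. -/
theorem integral_traceMinus_add_tracePlus (i : Fin d) (v : 𝓣.PiecewiseSpace) (φ : 𝓣.DGSpace r)
    (e : 𝓣.InteriorFace) :
    (∫ x in e.carrier, traceMinus i v.toFun e x * e.normal i *
        jump (DGSpace.toFun φ) e x ∂surface d) +
      ∫ x in e.carrier, tracePlus i v.toFun e x * e.normal i *
        jump (DGSpace.toFun φ) e x ∂surface d =
    2 * (e.normal i * (∫ x in e.carrier,
        jump (fun k x => v.toFun k x * DGSpace.toFun φ k x) e x ∂surface d) -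
      e.normal i * deltaDG e (jump v.toFun e) φ) := by
  have hint : ∀ {f : Euc d → ℝ}, ContinuousOn f e.carrier →
      IntegrableOn f e.carrier (surface d) := fun hf =>
    integrableOn_surface e.isCompact_carrier e.surface_carrier_lt_top hf
  have hφ := (continuous_jump_toFun φ e).continuousOn (s := e.carrier)
  have hf : ContinuousOn (fun x => v.toFun e.fst x * DGSpace.toFun φ e.fst x) e.carrier :=
    ((v.continuousOn e.fst).mono fun _ hx => e.mem_fst hx).mul
      (φ.continuous_toFun e.fst).continuousOn
  have hs : ContinuousOn (fun x => v.toFun e.snd x * DGSpace.toFun φ e.snd x) e.carrier :=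
    ((v.continuousOn e.snd).mono fun _ hx => e.mem_snd hx).mul
      (φ.continuous_toFun e.snd).continuousOn
  have havg : ContinuousOn (average (DGSpace.toFun φ) e) e.carrier :=
    (((φ.continuous_toFun e.fst).add (φ.continuous_toFun e.snd)).div_const 2).continuousOn
  have hj : IntegrableOn (jump (fun k x => v.toFun k x * DGSpace.toFun φ k x) e) e.carrier
      (surface d) := hint (hf.sub hs)
  have hd : IntegrableOn (fun x => jump v.toFun e x * average (DGSpace.toFun φ) e x) e.carrier
      (surface d) := hint ((v.continuousOn_jump e).mul havg)
  have hm : IntegrableOn (fun x => traceMinus i v.toFun e x * e.normal i *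
      jump (DGSpace.toFun φ) e x) e.carrier (surface d) :=
    hint (((continuousOn_traceMinus i v e).mul continuousOn_const).mul hφ)
  have hp : IntegrableOn (fun x => tracePlus i v.toFun e x * e.normal i *
      jump (DGSpace.toFun φ) e x) e.carrier (surface d) :=
    hint (((continuousOn_tracePlus i v e).mul continuousOn_const).mul hφ)
  unfold deltaDG
  rw [← mul_sub, ← integral_sub hj hd, ← integral_const_mul, ← integral_const_mul,
    ← integral_add hm hp]
  congr 1 with x
  simp only [traceMinus, tracePlus, jump, average]
  split_ifs <;> ring

/-- The mean of the two functionals that define the one-sided derivatives is the action of the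
distributional derivative on `V_r^h`. -/
theorem dgFunctional_add (i : Fin d) (v : 𝓣.PiecewiseSpace) (φ : 𝓣.DGSpace r) :
    dgFunctional (traceMinus i) 0 i v.toFun φ + dgFunctional (tracePlus i) 0 i v.toFun φ =
      2 * (brokenInner (v.weakPartial i) (DGSpace.toFun φ) -
        ∑ e : 𝓣.InteriorFace, e.normal i * deltaDG e (jump v.toFun e) φ) := by
  have hI := Finset.sum_congr rfl fun (e : 𝓣.InteriorFace) (_ : e ∈ Finset.univ) =>
    integral_traceMinus_add_tracePlus i v φ e
  rw [Finset.sum_add_distrib, ← Finset.mul_sum, Finset.sum_sub_distrib] at hI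
  have hB : ∑ e : 𝓣.BoundaryFace, ∫ x in e.carrier,
      v.toFun e.idx x * e.normal i * DGSpace.toFun φ e.idx x ∂surface d =
      ∑ e : 𝓣.BoundaryFace, e.normal i * ∫ x in e.carrier,
        v.toFun e.idx x * DGSpace.toFun φ e.idx x ∂surface d := by
    refine Finset.sum_congr rfl fun e _ => ?_
    rw [← integral_const_mul]
    congr 1 with x
    ring
  have hparts := brokenInner_lineDeriv i v (φ := DGSpace.toFun φ) fun k => φ.contDiff_toFun k
  rw [← DGSpace.partialDeriv_eq] at hparts
  rw [dgFunctional_zero, dgFunctional_zero, hB, hparts]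
  linarith

theorem existsUnique_isPartialMinus (r : ℕ) (i : Fin d) (v : 𝓣.PiecewiseSpace) :
    ∃! p : 𝓣.DGSpace r, IsPartialMinus 0 i v p :=
  DGSpace.existsUnique_brokenInner_eq
    (isLinearMap_dgFunctional i v (continuousOn_traceMinus i v))

theorem existsUnique_isPartialPlus (r : ℕ) (i : Fin d) (v : 𝓣.PiecewiseSpace) :
    ∃! p : 𝓣.DGSpace r, IsPartialPlus 0 i v p :=
  DGSpace.existsUnique_brokenInner_eq
    (isLinearMap_dgFunctional i v (continuousOn_tracePlus i v))

theorem brokenInner_partialCentral (i : Fin d) (v : 𝓣.PiecewiseSpace) (φ : 𝓣.DGSpace r) :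
    brokenInner (DGSpace.toFun (partialCentral r 0 0 i v)) (DGSpace.toFun φ) =
      brokenInner (v.weakPartial i) (DGSpace.toFun φ) -
        ∑ e : 𝓣.InteriorFace, e.normal i * deltaDG e (jump v.toFun e) φ := by
  have hm : IsPartialMinus 0 i v (partialMinus r 0 i v) :=
    Classical.epsilon_spec (existsUnique_isPartialMinus r i v).exists
  have hp : IsPartialPlus 0 i v (partialPlus r 0 i v) :=
    Classical.epsilon_spec (existsUnique_isPartialPlus r i v).exists
  have h : DGSpace.innerForm (partialCentral r 0 0 i v) φ = (1 / 2 : ℝ) *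
      (DGSpace.innerForm (partialMinus r 0 i v) φ + DGSpace.innerForm (partialPlus r 0 i v) φ) := by
    simp [partialCentral, mul_add]
  have h1 : DGSpace.innerForm (partialMinus r 0 i v) φ = _ := hm φ
  have h2 : DGSpace.innerForm (partialPlus r 0 i v) φ = _ := hp φ
  rw [h1, h2, dgFunctional_add] at h
  refine Eq.trans h ?_
  ring

end Mesh

end DGCalculus

theorem mainTheorem6 {d : ℕ} {Ω : TopologicalSpace.Opens (DGCalculus.Euc d)}
    (𝓣 : DGCalculus.Mesh Ω) (r : ℕ) (v : 𝓣.PiecewiseSpace) (i : Fin d) :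
    -- the one-sided discrete derivatives are well defined by their variational equations
    (∃! p : 𝓣.DGSpace r, DGCalculus.Mesh.IsPartialMinus 0 i v p) ∧
    (∃! p : 𝓣.DGSpace r, DGCalculus.Mesh.IsPartialPlus 0 i v p) ∧
    -- representation of the distributional derivative
    v.distDeriv i =
      DGCalculus.regularDist Ω (DGCalculus.Mesh.glue (v.weakPartial i)) -
        ∑ e : 𝓣.InteriorFace, e.normal i •
          DGCalculus.deltaDist Ω e.carrier (DGCalculus.Mesh.jump v.toFun e) ∧
    -- the central discrete derivative is the projection of the distributional derivative
    ∀ w : 𝓣.DGSpace r, w = DGCalculus.Mesh.partialCentral r 0 0 i v ↔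
      ∀ φ : 𝓣.DGSpace r,
        DGCalculus.Mesh.brokenInner (DGCalculus.Mesh.DGSpace.toFun w)
            (DGCalculus.Mesh.DGSpace.toFun φ) =
          DGCalculus.Mesh.brokenInner (v.weakPartial i) (DGCalculus.Mesh.DGSpace.toFun φ) -
            ∑ e : 𝓣.InteriorFace, e.normal i *
              DGCalculus.Mesh.deltaDG e (DGCalculus.Mesh.jump v.toFun e) φ := by
  refine ⟨DGCalculus.Mesh.existsUnique_isPartialMinus r i v,
    DGCalculus.Mesh.existsUnique_isPartialPlus r i v, DGCalculus.Mesh.distDeriv_eq v i, fun w => ?_⟩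
  refine ⟨fun h φ => by rw [h, DGCalculus.Mesh.brokenInner_partialCentral], fun h => ?_⟩
  refine DGCalculus.Mesh.DGSpace.innerForm_injective (LinearMap.ext fun φ => ?_)
  exact (h φ).trans (DGCalculus.Mesh.brokenInner_partialCentral i v φ).symm
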